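/- **Theorem (large sieve for characters of order $\ell$ over $\mathbb{F}_q[t]$).** Let $\mathbb{F}_q$ be a finite field and let $\varepsilon>0$. There is a constant $K=K(q,\varepsilon)>0$ such that the following holds. Let $\ell\ge 3$ be an integer with $q\equiv 1 \pmod{2\ell}$, and let $\Omega$ be an isomorphism from the group of $\ell$-th roots of unity in $\mathbb{F}_q^*$ to the group $\mu_\ell$ of $\ell$-th roots of unity in $\mathbb{C}^*$. For an irreducible monic polynomial $P\in\mathbb{F}_q[t]$ and $a\in\mathbb{F}_q[t]$ put $\left(\frac{a}{P}\right)_\ell=0$ if $P\mid a$, and otherwise let $\left(\frac{a}{P}\right)_\ell$ be the unique $\alpha\in\mu_\ell$ with $$a^{(q^{\deg P}-1)/\ell}\equiv \Omega^{-1}(\alpha) \pmod P ;$$ for a monic $c=P_1^{e_1}\cdots P_k^{e_k}$ with distinct monic irreducible $P_i$, put $\left(\frac{a}{c}\right)_\ell=\prod_{i}\left(\frac{a}{P_i}\right)_\ell^{e_i}$. For $d\ge 0$ let $\mathcal{H}_d$ be the set of monic square-free polynomials of degree $d$ in $\mathbb{F}_q[t]$. Then for all integers $m,n\ge 0$ and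 all complex numbers $\lambda(N)$, indexed by the monic polynomials $N\in\mathbb{F}_q[t]$, $$\sum_{M\in\mathcal{H}_m}\left|\sum_{N\in\mathcal{H}_n}\lambda(N)\left(\frac{M}{N}\right)_\ell\right|^2\le K\, q^{\varepsilon(m+n)}\left(q^m+q^n+q^{2(m+n)/3}\right)\sum_{N\in\mathcal{H}_n}|\lambda(N)|^2 .$$ -/

import Mathlib

open Polynomial

/-- There are finitely many monic square-free polynomials of a given degree over a finite field. -/
theorem finite_monicSquarefree (F : Type*) [Field F] [Fintype F] (d : ℕ) :
    {f : F[X] | f.Monic ∧ Squarefree f ∧ f.natDegree = d}.Finite := by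
  have h : Set.Finite ((fun (v : Fin (d + 1) → F) => ∑ i : Fin (d + 1), monomial (i : ℕ) (v i)) ''
      (Set.univ : Set (Fin (d + 1) → F))) := Set.toFinite _
  refine h.subset ?_
  rintro f ⟨-, -, hf⟩
  refine ⟨fun i => f.coeff i, trivial, ?_⟩
  have := f.as_sum_range' (d + 1) (by omega)
  conv_rhs => rw [this]
  exact Fin.sum_univ_eq_sum_range (fun i => monomial i (f.coeff i)) (d + 1)

/-- `monicSquarefree F d` is the set `𝓗_d` of monic square-free polynomials of degree `d`
in `F[t]`. -/
noncomputable def monicSquarefree (F : Type*) [Field F] [Fintype F] (d : ℕ) : Finset F[X] :=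
  (finite_monicSquarefree F d).toFinset

theorem mem_monicSquarefree {F : Type*} [Field F] [Fintype F] {d : ℕ} {f : F[X]} :
    f ∈ monicSquarefree F d ↔ f.Monic ∧ Squarefree f ∧ f.natDegree = d := by
  simp [monicSquarefree]

/-- For `P` irreducible not dividing `a` and `q ≡ 1 mod ℓ`, there is exactly one complex `ℓ`-th
root of unity `α` with `a ^ ((q ^ deg P - 1) / ℓ) ≡ Ω⁻¹(α) mod P`. -/
theorem existsUnique_primeResidue {F : Type*} [Field F] [Fintype F] {ℓ : ℕ}
    (hℓ : ℓ ≠ 0) (hq : ℓ ∣ Fintype.card F - 1)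
    (Ω : rootsOfUnity ℓ F ≃* rootsOfUnity ℓ ℂ) {P a : F[X]} (hP : Irreducible P)
    (ha : ¬ P ∣ a) :
    ∃! α : rootsOfUnity ℓ ℂ,
      P ∣ a ^ ((Fintype.card F ^ P.natDegree - 1) / ℓ) - C ((Ω.symm α : Fˣ) : F) := by
  have : NeZero ℓ := ⟨hℓ⟩
  have : Fact (Irreducible P) := ⟨hP⟩
  let K := AdjoinRoot P
  have hP0 : P ≠ 0 := hP.ne_zero
  have : Module.Finite F K := (AdjoinRoot.powerBasis hP0).finite
  have : Finite K := Module.finite_of_finite F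
  have : Fintype K := Fintype.ofFinite K
  have hcard : Fintype.card K = Fintype.card F ^ P.natDegree := by
    rw [Module.card_eq_pow_finrank (K := F) (V := K), (AdjoinRoot.powerBasis hP0).finrank,
      AdjoinRoot.powerBasis_dim]
  have hx : (AdjoinRoot.mk P a : K) ≠ 0 := by
    rwa [Ne, AdjoinRoot.mk_eq_zero]
  have hdvd : ℓ ∣ Fintype.card F ^ P.natDegree - 1 :=
    hq.trans (Nat.sub_one_dvd_pow_sub_one _ _)
  have hy : (AdjoinRoot.mk P a : K) ^ ((Fintype.card F ^ P.natDegree - 1) / ℓ) ≠ 0 :=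
    pow_ne_zero _ hx
  have hyℓ : Units.mk0 _ hy ∈ rootsOfUnity ℓ K := by
    rw [mem_rootsOfUnity]
    ext
    simp only [Units.val_pow_eq_pow_val, Units.val_mk0, Units.val_one]
    rw [← pow_mul, Nat.div_mul_cancel hdvd, ← hcard]
    exact FiniteField.pow_card_sub_one_eq_one _ hx
  have hinj : Function.Injective (restrictRootsOfUnity (AdjoinRoot.of P) ℓ) := by
    intro u v huv
    have h := congrArg (fun w : rootsOfUnity ℓ K => ((w : Kˣ) : K)) huv
    simp only [restrictRootsOfUnity_coe_apply] at h
    exact Subtype.ext (Units.ext ((AdjoinRoot.of P).injective h))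
  have hbij : Function.Bijective (restrictRootsOfUnity (AdjoinRoot.of P) ℓ) := by
    refine (Nat.bijective_iff_injective_and_card _).2 ⟨hinj, le_antisymm ?_ ?_⟩
    · exact Nat.card_le_card_of_injective _ hinj
    · rw [Nat.card_congr Ω.toEquiv, Complex.card_rootsOfUnity]
      exact card_rootsOfUnity K ℓ
  have key : ∀ α : rootsOfUnity ℓ ℂ,
      P ∣ a ^ ((Fintype.card F ^ P.natDegree - 1) / ℓ) - C ((Ω.symm α : Fˣ) : F) ↔
        restrictRootsOfUnity (AdjoinRoot.of P) ℓ (Ω.symm α) = ⟨Units.mk0 _ hy, hyℓ⟩ := by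
    intro α
    rw [← AdjoinRoot.mk_eq_zero, map_sub, sub_eq_zero, map_pow, AdjoinRoot.mk_C, Subtype.ext_iff,
      Units.ext_iff, restrictRootsOfUnity_coe_apply, Units.val_mk0]
    exact eq_comm
  obtain ⟨β, hβ, hβu⟩ := hbij.existsUnique ⟨Units.mk0 _ hy, hyℓ⟩
  refine ⟨Ω β, (key _).2 (by simpa using hβ), fun α hα => ?_⟩
  rw [← hβu _ ((key α).1 hα), MulEquiv.apply_symm_apply]

open Classical in
/-- The `ℓ`-th power residue symbol `(a / P)_ℓ` modulo an irreducible `P`: it is `0` if `P ∣ a`,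
and otherwise the unique complex `ℓ`-th root of unity `α` such that
`a ^ ((q ^ deg P - 1) / ℓ) ≡ Ω⁻¹(α) mod P` (see `existsUnique_primeResidue`), where `Ω` is the
fixed isomorphism between the groups of `ℓ`-th roots of unity of `F` and of `ℂ`. -/
noncomputable def primeResidueSymbol {F : Type*} [Field F] [Fintype F] {ℓ : ℕ}
    (Ω : rootsOfUnity ℓ F ≃* rootsOfUnity ℓ ℂ) (a P : F[X]) : ℂ :=
  if P ∣ a then 0
  else if h : ∃ α : rootsOfUnity ℓ ℂ,
      P ∣ a ^ ((Fintype.card F ^ P.natDegree - 1) / ℓ) - C ((Ω.symm α : Fˣ) : F) then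
    ((h.choose : ℂˣ) : ℂ)
  else 0

open Classical in
/-- The symbol `(a / c)_ℓ = ∏ (a / P_i)_ℓ ^ e_i` for `c = ∏ P_i ^ e_i` with `P_i` monic irreducible
(`normalizedFactors c` is the multiset of monic irreducible factors of `c`, with multiplicity). -/
noncomputable def residueSymbol {F : Type*} [Field F] [Fintype F] {ℓ : ℕ}
    (Ω : rootsOfUnity ℓ F ≃* rootsOfUnity ℓ ℂ) (a c : F[X]) : ℂ :=
  ((UniqueFactorizationMonoid.normalizedFactors c).map (primeResidueSymbol Ω a)).prod

/-!
The residue symbol `(M / N)_ℓ` equals `θ(Res(N, M))` for the character `θ(x) = Ω(x ^ ((q - 1) /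
ℓ))` of the constant field (`residueSymbol_eq`). Hence it is multiplicative in both arguments, and
it is symmetric because `θ(-1) = 1`. It is therefore a matrix to which the duality principle
applies in both directions, and it suffices to bound the squared norm `T_n(k)` of the matrix with
moduli `N` square-free of degree `n` and outer variables `M` of degree less than `k`
(`LargeSieveBound`), for `k ≥ n`.

Poisson summation (`poisson_resultantChar`) for `χ_{N₁} conj χ_{N₂}` transforms the sum over `M`
into a dual sum of length `2 n - k`. By reciprocity, the Gauss sum of the product character is the
product of a factor depending on `N₁` and one depending on `N₂`, so the dual sum is of the
original kind. After common factors have been removed by Möbius inversion, this gives, up to the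
divisor function, `T_n(k) ≲ q ^ k + q ^ (k - n) T_n(2 n - k)` and similar terms of smaller moduli
(`largeSieveBound_of_dual`).

The outer sum on the right is now short. Writing `M = u a b² c³` with `a` and `b` square-free
(`exists_eq_mul_sq_mul_cube`), one sums over `b` if `deg a ≤ deg b`, and over `a` otherwise. The
sum over `b` involves the characters of `θ²`, nontrivial because `ℓ ≥ 3`, and is so short that
duality and the orthogonality of characters bound it. The sum over `a` is turned by duality into
`T_α(n)` with `α = deg a` (`largeSieveBound_short`). If `k ≥ (1 + 1 / j) n`, then `T_α(n)` is in
the range of the same kind with `j - 1` in place of `j`. Induction on `j` gives the bound `q ^ k +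
q ^ (2 (n + k) / 3)` in this range (`exists_largeSieveBound_of_mul_le`), and monotonicity in `k`
extends it to `k ≥ n` at the cost of a factor `q ^ (ε k)`.
-/

/-! ### Characters of the resultant and power residue symbols -/

theorem resultant_eq_of_natDegree_le {K : Type*} [Field K] {N M : K[X]} (hN : N.Monic) {n : ℕ}
    (h : M.natDegree ≤ n) : resultant N M N.natDegree n = resultant N M := by
  obtain ⟨k, rfl⟩ := Nat.exists_eq_add_of_le h
  rw [resultant_add_right_deg _ _ _ _ _ le_rfl, hN.coeff_natDegree, one_pow, one_mul]

/-- The symbol `χ_N(M) = θ(Res(N, M))` attached to a multiplicative character `θ` of the constant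
field. For `N` monic it is a multiplicative character modulo `N`; with `θ(x) = Ω(x ^ ((q - 1) /
ℓ))` it is the `ℓ`-th power residue symbol, and the choice of the resultant makes both
multiplicativity in `N` and reciprocity immediate. -/
noncomputable def resultantChar {F : Type*} [Field F] (θ : MulChar F ℂ) (N M : F[X]) : ℂ :=
  θ (resultant N M)

section
variable {F : Type*} [Field F] (θ : MulChar F ℂ)

theorem resultantChar_mul_right {N : F[X]} (hN : N.Monic) (A B : F[X]) :
    resultantChar θ N (A * B) = resultantChar θ N A * resultantChar θ N B := by
  unfold resultantChar
  rw [← map_mul, ← resultant_mul_right _ _ _ _ le_rfl,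
    resultant_eq_of_natDegree_le hN natDegree_mul_le]

theorem resultantChar_mul_left {A B : F[X]} (hA : A.Monic) (hB : B.Monic) (M : F[X]) :
    resultantChar θ (A * B) M = resultantChar θ A M * resultantChar θ B M := by
  unfold resultantChar
  rw [← map_mul, ← resultant_mul_left _ _ _ _ le_rfl, hA.natDegree_mul hB]

theorem resultantChar_one_left (M : F[X]) : resultantChar θ 1 M = 1 := by
  simp [resultantChar]

theorem resultantChar_add_mul {N : F[X]} (hN : N.Monic) (M Q : F[X]) :
    resultantChar θ N (M + N * Q) = resultantChar θ N M := by
  unfold resultantChar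
  let n := max M.natDegree (Q.natDegree + N.natDegree)
  have h1 : M.natDegree ≤ n := le_max_left _ _
  have h2 : Q.natDegree + N.natDegree ≤ n := le_max_right _ _
  have h3 : (M + N * Q).natDegree ≤ n :=
    natDegree_add_le_of_degree_le h1 (natDegree_mul_le.trans (by omega))
  rw [← resultant_eq_of_natDegree_le hN h1, ← resultant_eq_of_natDegree_le hN h3,
    resultant_add_mul_right _ _ _ _ _ h2 le_rfl]

theorem resultantChar_congr {N : F[X]} (hN : N.Monic) {A B : F[X]} (h : N ∣ A - B) :
    resultantChar θ N A = resultantChar θ N B := by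
  obtain ⟨Q, hQ⟩ := h
  rw [show A = B + N * Q by rw [← hQ]; ring, resultantChar_add_mul θ hN]

theorem resultantChar_modByMonic {N : F[X]} (hN : N.Monic) (A : F[X]) :
    resultantChar θ N (A %ₘ N) = resultantChar θ N A := by
  refine resultantChar_congr θ hN ⟨-(A /ₘ N), ?_⟩
  have := modByMonic_add_div A N
  linear_combination this

variable {θ} in
/-- Reciprocity, from `Res(N, M) = (-1) ^ (deg N deg M) Res(M, N)`. -/
theorem resultantChar_comm (hθ : θ (-1) = 1) (N M : F[X]) :
    resultantChar θ N M = resultantChar θ M N := by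
  unfold resultantChar
  rw [resultant_comm, map_mul, map_pow, hθ, one_pow, one_mul]

theorem resultantChar_eq_zero_iff {N : F[X]} (hN : N.Monic) {M : F[X]} :
    resultantChar θ N M = 0 ↔ ¬ IsCoprime N M := by
  unfold resultantChar
  have h : θ (resultant N M) = 0 ↔ resultant N M = 0 := by
    refine ⟨fun h => ?_, fun h => by rw [h, MulChar.map_zero]⟩
    by_contra h0
    exact ((isUnit_iff_ne_zero.2 h0).map θ).ne_zero h
  rw [h, resultant_eq_zero_iff]
  simp [hN.ne_zero]

theorem resultantChar_neg_right (hθ : θ (-1) = 1) {N : F[X]} (hN : N.Monic) (M : F[X]) :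
    resultantChar θ N (-M) = resultantChar θ N M := by
  rw [show -M = C (-1) * M by simp, resultantChar_mul_right θ hN]
  simp [resultantChar, hθ, -map_neg]

theorem resultantChar_pow (j : ℕ) (hj : j ≠ 0) (N M : F[X]) :
    resultantChar (θ ^ j) N M = resultantChar θ N M ^ j := by
  simp [resultantChar, MulChar.pow_apply' θ hj]

theorem resultantChar_pow_right {N : F[X]} (hN : N.Monic) (A : F[X]) (j : ℕ) :
    resultantChar θ N (A ^ j) = resultantChar θ N A ^ j := by
  induction j with
  | zero => simp [resultantChar]
  | succ j ih => rw [pow_succ, resultantChar_mul_right θ hN, ih, pow_succ]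

variable [Fintype F]

theorem MulChar.norm_apply_eq_one {x : F} (hx : x ≠ 0) : ‖θ x‖ = 1 := by
  refine Complex.norm_eq_one_of_pow_eq_one (n := Fintype.card F - 1) ?_ ?_
  · rw [← map_pow, FiniteField.pow_card_sub_one_eq_one _ hx, map_one]
  · have := Fintype.one_lt_card (α := F); omega

theorem norm_resultantChar_le_one (N M : F[X]) : ‖resultantChar θ N M‖ ≤ 1 := by
  unfold resultantChar
  by_cases h : resultant N M = 0
  · rw [h, MulChar.map_zero]; simp
  · exact (MulChar.norm_apply_eq_one θ h).le

theorem norm_resultantChar_of_isCoprime {N M : F[X]} (h : IsCoprime N M) :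
    ‖resultantChar θ N M‖ = 1 :=
  MulChar.norm_apply_eq_one θ fun h0 => (resultant_eq_zero_iff.1 h0).2 h

theorem resultant_eq_norm {P : F[X]} (hP : Irreducible P) (hm : P.Monic) (a : F[X]) :
    resultant P a = Algebra.norm F (AdjoinRoot.mk P a) := by
  have : Fact (Irreducible P) := ⟨hP⟩
  have hP0 : P ≠ 0 := hP.ne_zero
  have : Module.Finite F (AdjoinRoot P) := (AdjoinRoot.powerBasis hP0).finite
  have : Finite (AdjoinRoot P) := Module.finite_of_finite F
  let E := AlgebraicClosure F
  apply (algebraMap F E).injective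
  let pb := AdjoinRoot.powerBasis hP0
  have hmin : minpoly F pb.gen = P := by
    simp only [pb, AdjoinRoot.powerBasis_gen, AdjoinRoot.minpoly_root hP0, hm.leadingCoeff]
    simp
  rw [Algebra.norm_eq_prod_embeddings F E, ← resultant_map_map]
  have hspl : (P.map (algebraMap F E)).Splits := IsAlgClosed.splits _
  have h1 := resultant_eq_prod_eval (P.map (algebraMap F E)) (a.map (algebraMap F E))
    (a.map (algebraMap F E)).natDegree le_rfl hspl
  rw [natDegree_map, natDegree_map] at h1
  rw [h1, (hm.map _).leadingCoeff, one_pow, one_mul]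
  have hsep : IsSeparable F pb.gen := Algebra.IsSeparable.isSeparable F pb.gen
  have hnodup : (P.map (algebraMap F E)).roots.Nodup := by
    have := hsep
    unfold IsSeparable at this
    rw [hmin] at this
    exact nodup_roots this.map
  classical
  rw [show (Multiset.map (fun x => eval x (a.map (algebraMap F E)))
    (P.map (algebraMap F E)).roots).prod = ∏ x ∈ (P.map (algebraMap F E)).roots.toFinset,
      eval x (a.map (algebraMap F E)) by
    rw [Finset.prod_eq_multiset_prod, Multiset.toFinset_val, hnodup.dedup]]
  symm
  refine Finset.prod_bij (fun σ _ => σ pb.gen) ?_ ?_ ?_ ?_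
  · intro σ _
    simp only [Multiset.mem_toFinset, mem_roots', IsRoot.def, eval_map_algebraMap]
    refine ⟨(hm.map _).ne_zero, ?_⟩
    have h0 := minpoly.aeval F pb.gen
    rw [hmin] at h0
    rw [aeval_algHom_apply, h0, map_zero]
  · intro σ _ τ _ h
    exact pb.algHom_ext h
  · intro x hx
    simp only [Multiset.mem_toFinset, mem_roots', IsRoot.def, eval_map_algebraMap] at hx
    refine ⟨pb.lift x (by rw [hmin]; exact hx.2), Finset.mem_univ _, pb.lift_gen _ _⟩
  · intro σ _
    rw [eval_map_algebraMap, aeval_algHom_apply]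
    simp [pb, AdjoinRoot.aeval_eq]

theorem exists_resultantChar_ne_one {θ : MulChar F ℂ} (hθ : θ ≠ 1) {P : F[X]} (hP : Irreducible P)
    (hm : P.Monic) : ∃ u : F[X], IsCoprime P u ∧ resultantChar θ P u ≠ 1 := by
  have : Fact (Irreducible P) := ⟨hP⟩
  have hP0 : P ≠ 0 := hP.ne_zero
  have : Module.Finite F (AdjoinRoot P) := (AdjoinRoot.powerBasis hP0).finite
  have : Finite (AdjoinRoot P) := Module.finite_of_finite F
  obtain ⟨x, hx⟩ : ∃ x : Fˣ, θ x ≠ 1 := by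
    by_contra! h
    exact hθ (MulChar.ext fun a => by rw [h a, MulChar.one_apply_coe])
  obtain ⟨y, hy⟩ := FiniteField.norm_surjective F (AdjoinRoot P) x
  obtain ⟨u, rfl⟩ := AdjoinRoot.mk_surjective y
  have h : resultant P u = x := by rw [resultant_eq_norm hP hm, hy]
  refine ⟨u, ?_, by rwa [resultantChar, h]⟩
  by_contra hc
  have := resultant_eq_zero_iff.2 ⟨Or.inl hP0, hc⟩
  exact x.ne_zero (h ▸ this)

end

section
variable {F : Type*} [Field F] [Fintype F] {ℓ : ℕ}

theorem pow_card_sub_one_div_mem_rootsOfUnity (hℓ : ℓ ∣ Fintype.card F - 1) (x : Fˣ) :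
    x ^ ((Fintype.card F - 1) / ℓ) ∈ rootsOfUnity ℓ F := by
  rw [mem_rootsOfUnity, ← pow_mul, Nat.div_mul_cancel hℓ]
  ext
  simpa using FiniteField.pow_card_sub_one_eq_one (x : F) x.ne_zero

/-- The character `x ↦ Ω(x ^ ((q - 1) / ℓ))` of `F`, extended by `0` at `0`. -/
noncomputable def residueMulChar (hℓ : ℓ ∣ Fintype.card F - 1)
    (Ω : rootsOfUnity ℓ F ≃* rootsOfUnity ℓ ℂ) : MulChar F ℂ :=
  MulChar.ofUnitHom
    { toFun := fun x => (Ω ⟨x ^ ((Fintype.card F - 1) / ℓ),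
        pow_card_sub_one_div_mem_rootsOfUnity hℓ x⟩ : ℂˣ)
      map_one' := by
        simp
      map_mul' := fun x y => by
        rw [← Subgroup.coe_mul, ← map_mul]
        congr 2
        exact Subtype.ext (mul_pow x y _) }

theorem residueMulChar_coe (hℓ : ℓ ∣ Fintype.card F - 1)
    (Ω : rootsOfUnity ℓ F ≃* rootsOfUnity ℓ ℂ) (x : Fˣ) (h) :
    residueMulChar hℓ Ω x = ((Ω ⟨x ^ ((Fintype.card F - 1) / ℓ), h⟩ : ℂˣ) : ℂ) := by
  rw [residueMulChar, MulChar.ofUnitHom_coe]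
  rfl

theorem residueMulChar_neg_one (hℓ : ℓ ∣ Fintype.card F - 1)
    (h2 : Even ((Fintype.card F - 1) / ℓ))
    (Ω : rootsOfUnity ℓ F ≃* rootsOfUnity ℓ ℂ) : residueMulChar hℓ Ω (-1) = 1 := by
  have h := residueMulChar_coe hℓ Ω (-1) (by simp [h2.neg_pow])
  simp only [h2.neg_pow, one_pow] at h
  rw [Units.val_neg, Units.val_one] at h
  rw [h]
  have : (⟨1, by simp⟩ : rootsOfUnity ℓ F) = 1 := rfl
  rw [this, map_one]
  rfl

theorem residueMulChar_sq_ne_one (hℓ : ℓ ∣ Fintype.card F - 1) (h3 : 3 ≤ ℓ)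
    (Ω : rootsOfUnity ℓ F ≃* rootsOfUnity ℓ ℂ) : residueMulChar hℓ Ω ^ 2 ≠ 1 := by
  intro h
  -- otherwise the order `q - 1` of a generator of `Fˣ` would divide `2 (q - 1) / ℓ`
  obtain ⟨g, hg⟩ := IsCyclic.exists_generator (α := Fˣ)
  have h1 : (residueMulChar hℓ Ω ^ 2) g = 1 := by rw [h, MulChar.one_apply_coe]
  have hmem := pow_card_sub_one_div_mem_rootsOfUnity hℓ g
  rw [MulChar.pow_apply_coe, residueMulChar_coe hℓ Ω g hmem] at h1
  have h2 : Ω ⟨_, hmem⟩ ^ 2 = 1 := by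
    ext
    simpa using h1
  rw [← map_pow, map_eq_one_iff _ Ω.injective] at h2
  have h4 : g ^ ((Fintype.card F - 1) / ℓ * 2) = 1 := by
    have := congrArg Subtype.val h2
    rwa [SubmonoidClass.coe_pow, ← pow_mul] at this
  have h5 := orderOf_dvd_of_pow_eq_one h4
  rw [orderOf_eq_card_of_forall_mem_zpowers hg, Nat.card_units, Nat.card_eq_fintype_card] at h5
  have hpos : 0 < Fintype.card F - 1 := by have := Fintype.one_lt_card (α := F); omega
  have hq := Nat.div_pos (Nat.le_of_dvd hpos hℓ) (by omega)
  have h6 := Nat.le_of_dvd (by positivity) h5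
  have h7 := Nat.div_mul_cancel hℓ
  nlinarith

theorem primeResidueSymbol_eq (hℓ : ℓ ∣ Fintype.card F - 1) (hℓ0 : ℓ ≠ 0)
    (Ω : rootsOfUnity ℓ F ≃* rootsOfUnity ℓ ℂ) {P : F[X]} (hP : Irreducible P) (hm : P.Monic)
    (a : F[X]) : primeResidueSymbol Ω a P = resultantChar (residueMulChar hℓ Ω) P a := by
  unfold primeResidueSymbol
  by_cases ha : P ∣ a
  · rw [if_pos ha, eq_comm, resultantChar_eq_zero_iff _ hm, hP.coprime_iff_not_dvd, not_not]
    exact ha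
  · rw [if_neg ha]
    have hu := existsUnique_primeResidue hℓ0 hℓ Ω hP ha
    rw [dif_pos hu.exists]
    have : Fact (Irreducible P) := ⟨hP⟩
    have hP0 : P ≠ 0 := hP.ne_zero
    have : Module.Finite F (AdjoinRoot P) := (AdjoinRoot.powerBasis hP0).finite
    have : Finite (AdjoinRoot P) := Module.finite_of_finite F
    have : Fintype (AdjoinRoot P) := Fintype.ofFinite _
    have hcard : Nat.card (AdjoinRoot P) = Fintype.card F ^ P.natDegree := by
      rw [Nat.card_eq_fintype_card, Module.card_eq_pow_finrank (K := F) (V := AdjoinRoot P),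
        (AdjoinRoot.powerBasis hP0).finrank, AdjoinRoot.powerBasis_dim]
    have hres : resultant P a ≠ 0 := fun h =>
      (resultant_eq_zero_iff.1 h).2 (hP.coprime_iff_not_dvd.2 ha)
    have hmem := pow_card_sub_one_div_mem_rootsOfUnity hℓ (Units.mk0 _ hres)
    have hval := residueMulChar_coe hℓ Ω (Units.mk0 _ hres) hmem
    rw [Units.val_mk0] at hval
    rw [resultantChar, hval]
    congr 2
    refine hu.unique hu.exists.choose_spec ?_
    rw [MulEquiv.symm_apply_apply, ← AdjoinRoot.mk_eq_zero, map_sub, sub_eq_zero, map_pow,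
      AdjoinRoot.mk_C]
    have hn := FiniteField.algebraMap_norm_eq_pow (K := F) (x := AdjoinRoot.mk P a)
    rw [← resultant_eq_norm hP hm, hcard, Nat.card_eq_fintype_card] at hn
    simp only [Units.val_pow_eq_pow_val, Units.val_mk0, map_pow]
    rw [← AdjoinRoot.algebraMap_eq, hn, ← pow_mul]
    congr 1
    exact (Nat.div_mul_div_comm (Nat.sub_one_dvd_pow_sub_one _ _) hℓ).symm ▸ by
      rw [mul_comm (Fintype.card F - 1) ℓ, Nat.mul_div_mul_right]
      have := Fintype.one_lt_card (α := F); omega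

/-- The power residue symbol is a character of the resultant: for `P` irreducible, `Res(P, a)` is
the norm of `a mod P` (`resultant_eq_norm`), that is `a ^ ((q ^ deg P - 1) / (q - 1))`. -/
theorem residueSymbol_eq (hℓ : ℓ ∣ Fintype.card F - 1) (hℓ0 : ℓ ≠ 0)
    (Ω : rootsOfUnity ℓ F ≃* rootsOfUnity ℓ ℂ) {N : F[X]} (hm : N.Monic) (a : F[X]) :
    residueSymbol Ω a N = resultantChar (residueMulChar hℓ Ω) N a := by
  classical
  have key : ∀ s : Multiset F[X], (∀ P ∈ s, Irreducible P ∧ P.Monic) → s.prod.Monic ∧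
      (s.map (primeResidueSymbol Ω a)).prod = resultantChar (residueMulChar hℓ Ω) s.prod a := by
    intro s
    induction s using Multiset.induction_on with
    | empty => simp [resultantChar_one_left]
    | cons P s ih =>
      intro h
      obtain ⟨h1, h2⟩ := ih fun Q hQ => h Q (Multiset.mem_cons_of_mem hQ)
      obtain ⟨hP, hPm⟩ := h P (Multiset.mem_cons_self _ _)
      rw [Multiset.prod_cons, Multiset.map_cons, Multiset.prod_cons, h2,
        resultantChar_mul_left _ hPm h1, primeResidueSymbol_eq hℓ hℓ0 Ω hP hPm]
      exact ⟨hPm.mul h1, rfl⟩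
  have h := (key (UniqueFactorizationMonoid.normalizedFactors N) fun P hP =>
    ⟨UniqueFactorizationMonoid.irreducible_of_normalized_factor P hP, by
      have h1 := UniqueFactorizationMonoid.normalize_normalized_factor P hP
      rw [← h1]
      exact monic_normalize
        (UniqueFactorizationMonoid.irreducible_of_normalized_factor P hP).ne_zero⟩).2
  have hprod : (UniqueFactorizationMonoid.normalizedFactors N).prod = N := by
    rw [UniqueFactorizationMonoid.prod_normalizedFactors_eq hm.ne_zero, hm.normalize_eq_self]
  rw [residueSymbol, h, hprod]

end

/-! ### Additive characters, Gauss sums and Poisson summation -/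

section
open ComplexConjugate
variable {F : Type*} [Field F]

theorem resultantChar_one_right (θ : MulChar F ℂ) (N : F[X]) : resultantChar θ N 1 = 1 := by
  by_cases h : N = 0 <;> simp [resultantChar, h]

theorem exists_monic_irreducible_dvd {N h : F[X]} (hc : ¬ IsCoprime N h) :
    ∃ P : F[X], P.Monic ∧ Irreducible P ∧ P ∣ N ∧ P ∣ h := by
  classical
  rw [← EuclideanDomain.gcd_isUnit_iff] at hc
  obtain ⟨P, hm, hP, hd⟩ := exists_monic_irreducible_factor _ hc
  exact ⟨P, hm, hP, hd.trans (EuclideanDomain.gcd_dvd_left _ _),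
    hd.trans (EuclideanDomain.gcd_dvd_right _ _)⟩

/-- The additive character `x ↦ e(x / N)` modulo a monic `N`, where `e` is `ψ` of the coefficient
of `t⁻¹` in the Laurent expansion at infinity. For `x` reduced modulo `N` this coefficient is that
of `t ^ (deg N - 1)` in `x`. For `N = 1` the remainder is `0`, so the truncated subtraction is
harmless. -/
noncomputable def polyExp (ψ : AddChar F ℂ) (N x : F[X]) : ℂ :=
  ψ ((x %ₘ N).coeff (N.natDegree - 1))

section
variable (ψ : AddChar F ℂ)

theorem polyExp_add (N x y : F[X]) : polyExp ψ N (x + y) = polyExp ψ N x * polyExp ψ N y := by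
  simp [polyExp, add_modByMonic, AddChar.map_add_eq_mul]

theorem polyExp_zero (N : F[X]) : polyExp ψ N 0 = 1 := by
  simp [polyExp]

theorem polyExp_congr {N : F[X]} (hN : N.Monic) {x y : F[X]} (h : N ∣ x - y) :
    polyExp ψ N x = polyExp ψ N y := by
  rw [polyExp, polyExp, modByMonic_eq_of_dvd_sub hN h]

/-- The value `e(x / N)` depends only on the fraction: `e(x N' / (N N')) = e(x / N)`. -/
theorem polyExp_mul_right {N N' : F[X]} (hN : N.Monic) (hN' : N'.Monic) (x : F[X]) :
    polyExp ψ (N * N') (x * N') = polyExp ψ N x := by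
  unfold polyExp
  have h1 : (x * N') %ₘ (N * N') = (x %ₘ N) * N' := by
    refine (div_modByMonic_unique (x /ₘ N) _ (hN.mul hN') ⟨?_, ?_⟩).2
    · linear_combination N' * modByMonic_add_div x N
    · rw [hN'.degree_mul, hN'.degree_mul]
      refine WithBot.add_lt_add_right (by simp [hN'.ne_zero]) (degree_modByMonic_lt _ hN)
  rw [h1, hN.natDegree_mul hN']
  rcases Nat.eq_zero_or_pos N.natDegree with h0 | h0
  · have : N = 1 := hN.natDegree_eq_zero.1 h0
    subst this
    simp
  · have h2 : (x %ₘ N).natDegree ≤ N.natDegree - 1 := by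
      have := natDegree_modByMonic_lt x hN (fun h => by simp [h] at h0)
      omega
    rw [show N.natDegree + N'.natDegree - 1 = (N.natDegree - 1) + N'.natDegree by omega,
      coeff_mul_add_eq_of_natDegree_le h2 le_rfl, hN'.coeff_natDegree, mul_one]

end

end

section
open ComplexConjugate
variable (F : Type*) [Field F] [Fintype F]

/-- The finite set of polynomials of degree less than `k`, including `0`. -/
noncomputable def polyLT (k : ℕ) : Finset F[X] :=
  Finset.univ.map ⟨fun v : Fin k → F => (((degreeLTEquiv F k).symm v : degreeLT F k) : F[X]),
    Subtype.val_injective.comp (degreeLTEquiv F k).symm.injective⟩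

theorem card_polyLT (k : ℕ) : (polyLT F k).card = Fintype.card F ^ k := by
  simp [polyLT]

variable {F}

theorem mem_polyLT {k : ℕ} {f : F[X]} : f ∈ polyLT F k ↔ f.degree < k := by
  rw [← mem_degreeLT, polyLT]
  simp only [Finset.mem_map, Finset.mem_univ, true_and, Function.Embedding.coeFn_mk]
  constructor
  · rintro ⟨v, rfl⟩
    exact Subtype.property _
  · intro h
    exact ⟨degreeLTEquiv F k ⟨f, h⟩, by simp⟩

theorem zero_mem_polyLT (k : ℕ) : (0 : F[X]) ∈ polyLT F k := by
  simp [mem_polyLT]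

theorem mem_polyLT_zero {f : F[X]} : f ∈ polyLT F 0 ↔ f = 0 := by
  rw [mem_polyLT]
  simp

theorem polyLT_zero : polyLT F 0 = {0} := by
  ext f
  rw [mem_polyLT_zero, Finset.mem_singleton]

theorem polyLT_mono {k l : ℕ} (h : k ≤ l) : polyLT F k ⊆ polyLT F l := by
  intro f hf
  rw [mem_polyLT] at *
  exact hf.trans_le (by exact_mod_cast h)

theorem add_mem_polyLT {k : ℕ} {f g : F[X]} (hf : f ∈ polyLT F k) (hg : g ∈ polyLT F k) :
    f + g ∈ polyLT F k := by
  rw [mem_polyLT] at *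
  exact (degree_add_le _ _).trans_lt (max_lt hf hg)

theorem sub_mem_polyLT {k : ℕ} {f g : F[X]} (hf : f ∈ polyLT F k) (hg : g ∈ polyLT F k) :
    f - g ∈ polyLT F k := by
  rw [mem_polyLT] at *
  exact (degree_sub_le _ _).trans_lt (max_lt hf hg)

theorem modByMonic_mem_polyLT {N : F[X]} (hN : N.Monic) (f : F[X]) :
    f %ₘ N ∈ polyLT F N.natDegree := by
  rw [mem_polyLT, ← degree_eq_natDegree hN.ne_zero]
  exact degree_modByMonic_lt f hN

theorem mul_mem_polyLT {N : F[X]} (hN : N.Monic) {k : ℕ} {f : F[X]} (hf : f ∈ polyLT F k) :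
    f * N ∈ polyLT F (k + N.natDegree) := by
  rw [mem_polyLT] at *
  rw [hN.degree_mul, degree_eq_natDegree hN.ne_zero, Nat.cast_add]
  exact WithBot.add_lt_add_right (by simp) hf

theorem eq_of_mem_polyLT_of_dvd_sub {N : F[X]} (hN : N.Monic) {f g : F[X]}
    (hf : f ∈ polyLT F N.natDegree) (hg : g ∈ polyLT F N.natDegree) (h : N ∣ f - g) : f = g := by
  have h1 := sub_mem_polyLT hf hg
  rw [mem_polyLT, ← degree_eq_natDegree hN.ne_zero] at h1
  exact sub_eq_zero.1 (eq_zero_of_dvd_of_degree_lt h h1)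

theorem polyExp_neg (ψ : AddChar F ℂ) (N x : F[X]) : polyExp ψ N (-x) = conj (polyExp ψ N x) := by
  rw [polyExp, polyExp, ← AddChar.map_neg_eq_conj, neg_modByMonic, coeff_neg]

variable (ψ : AddChar F ℂ)

/-- Orthogonality: the Fourier transform of the ball `{deg M < k}` is `q ^ k` times the indicator
of the dual ball `{deg (h / N) < -k}`. The subtraction is truncated: for `k ≥ deg N` the dual ball
is `{0}`. -/
theorem sum_polyExp_mul {ψ : AddChar F ℂ} (hψ : ψ ≠ 1) {N : F[X]} (hN : N.Monic) (k : ℕ) {h : F[X]}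
    (hh : h ∈ polyLT F N.natDegree) [Decidable (h ∈ polyLT F (N.natDegree - k))] :
    ∑ M ∈ polyLT F k, polyExp ψ N (M * h) =
      if h ∈ polyLT F (N.natDegree - k) then (Fintype.card F : ℂ) ^ k else 0 := by
  split_ifs with hk
  · have : ∀ M ∈ polyLT F k, polyExp ψ N (M * h) = 1 := by
      intro M hM
      by_cases h0 : M = 0 ∨ h = 0
      · have : M * h = 0 := by rcases h0 with h0 | h0 <;> simp [h0]
        rw [this, polyExp_zero]
      push Not at h0
      rw [mem_polyLT, degree_eq_natDegree (by tauto), Nat.cast_lt] at hM hk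
      have hd : (M * h).natDegree + 1 < N.natDegree := by
        rw [natDegree_mul h0.1 h0.2]; omega
      rw [polyExp, (modByMonic_eq_self_iff hN).2
        (degree_lt_degree (by omega)), coeff_eq_zero_of_natDegree_lt (by omega),
        AddChar.map_zero_eq_one]
    rw [Finset.sum_congr rfl this]
    simp [card_polyLT]
  · obtain ⟨M₀, hM₀, hne⟩ : ∃ M₀ ∈ polyLT F k, polyExp ψ N (M₀ * h) ≠ 1 := by
      have h0 : h ≠ 0 := fun h0 => hk (h0 ▸ zero_mem_polyLT _)
      rw [mem_polyLT, degree_eq_natDegree h0, Nat.cast_lt] at hh hk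
      obtain ⟨x, hx⟩ : ∃ x, ψ x ≠ 1 := by
        by_contra! hc
        exact hψ (DFunLike.ext _ _ fun a => by rw [hc a, AddChar.one_apply])
      have hlc : h.leadingCoeff ≠ 0 := leadingCoeff_ne_zero.2 h0
      refine ⟨C (x / h.leadingCoeff) * X ^ (N.natDegree - 1 - h.natDegree), ?_, ?_⟩
      · rw [mem_polyLT]
        refine (degree_C_mul_X_pow_le _ _).trans_lt ?_
        rw [Nat.cast_lt]; omega
      · have hd : (C (x / h.leadingCoeff) * X ^ (N.natDegree - 1 - h.natDegree) * h).natDegree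
            < N.natDegree := by
          refine (natDegree_mul_le.trans
            (Nat.add_le_add_right (natDegree_C_mul_X_pow_le _ _) _)).trans_lt ?_
          omega
        rw [polyExp, (modByMonic_eq_self_iff hN).2 (degree_lt_degree hd), mul_assoc, coeff_C_mul,
          show N.natDegree - 1 = h.natDegree + (N.natDegree - 1 - h.natDegree) by omega,
          add_tsub_cancel_left, coeff_X_pow_mul, coeff_natDegree, div_mul_cancel₀ _ hlc]
        exact hx
    have hs : ∑ M ∈ polyLT F k, polyExp ψ N (M * h) =
        polyExp ψ N (M₀ * h) * ∑ M ∈ polyLT F k, polyExp ψ N (M * h) := by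
      rw [Finset.mul_sum]
      refine Finset.sum_nbij' (fun M => M - M₀) (fun M => M + M₀) ?_ ?_ ?_ ?_ ?_
      · intro M hM; exact sub_mem_polyLT hM hM₀
      · intro M hM; exact add_mem_polyLT hM hM₀
      · intro M _; ring
      · intro M _; ring
      · intro M _
        rw [← polyExp_add]
        congr 1
        ring
    have h1 : (1 - polyExp ψ N (M₀ * h)) * ∑ M ∈ polyLT F k, polyExp ψ N (M * h) = 0 := by
      linear_combination hs
    exact (mul_eq_zero.1 h1).resolve_left (sub_ne_zero.2 hne.symm)

theorem sum_polyExp_mul_sub {ψ : AddChar F ℂ} (hψ : ψ ≠ 1) {N : F[X]} (hN : N.Monic) {x y : F[X]}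
    (hx : x ∈ polyLT F N.natDegree) (hy : y ∈ polyLT F N.natDegree) [Decidable (x = y)] :
    ∑ h ∈ polyLT F N.natDegree, polyExp ψ N (h * (x - y)) =
      if x = y then (Fintype.card F : ℂ) ^ N.natDegree else 0 := by
  classical
  rw [sum_polyExp_mul hψ hN _ (sub_mem_polyLT hx hy), Nat.sub_self]
  simp only [mem_polyLT_zero, sub_eq_zero]

/-- Multiplication by a unit modulo `N` permutes the residues modulo `N`. -/
theorem sum_polyLT_mul_unit {N u : F[X]} (hN : N.Monic) (hu : IsCoprime N u) {f : F[X] → ℂ}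
    (hf : ∀ x y, N ∣ x - y → f x = f y) :
    ∑ x ∈ polyLT F N.natDegree, f (x * u) = ∑ x ∈ polyLT F N.natDegree, f x := by
  obtain ⟨a, v, hav⟩ := hu
  have key : ∀ w w' : F[X], w' * w = 1 - a * N → ∀ x ∈ polyLT F N.natDegree,
      ((x * w) %ₘ N * w') %ₘ N = x := by
    intro w w' hw x hx
    refine eq_of_mem_polyLT_of_dvd_sub hN (modByMonic_mem_polyLT hN _) hx ?_
    have h1 := dvd_modByMonic_sub ((x * w) %ₘ N * w') N
    obtain ⟨c, hc⟩ := dvd_modByMonic_sub (x * w) N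
    obtain ⟨d, hd⟩ := h1
    exact ⟨d + c * w' - x * a, by linear_combination hd + w' * hc + x * hw⟩
  refine Finset.sum_nbij' (fun x => (x * u) %ₘ N) (fun x => (x * v) %ₘ N) ?_ ?_ ?_ ?_ ?_
  · intro x _; exact modByMonic_mem_polyLT hN _
  · intro x _; exact modByMonic_mem_polyLT hN _
  · intro x hx; exact key u v (by linear_combination hav) x hx
  · intro x hx; exact key v u (by linear_combination hav) x hx
  · intro x _
    refine (hf _ _ (dvd_modByMonic_sub _ N)).symm

variable (θ : MulChar F ℂ)

/-- The finite Fourier transform `∑_{x mod N} χ_N(x) e(x h / N)`; for `h = 1` it is the Gauss sum.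
-/
noncomputable def twistedGaussSum (N h : F[X]) : ℂ :=
  ∑ x ∈ polyLT F N.natDegree, resultantChar θ N x * polyExp ψ N (x * h)

theorem twistedGaussSum_mul_unit {N u : F[X]} (hN : N.Monic) (hu : IsCoprime N u) (h : F[X]) :
    resultantChar θ N u * twistedGaussSum ψ θ N (u * h) = twistedGaussSum ψ θ N h := by
  unfold twistedGaussSum
  rw [← sum_polyLT_mul_unit hN hu (f := fun x => resultantChar θ N x * polyExp ψ N (x * h)),
    Finset.mul_sum]
  · refine Finset.sum_congr rfl fun x _ => ?_
    rw [resultantChar_mul_right θ hN, mul_assoc x u h]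
    ring
  · intro x y hxy
    rw [resultantChar_congr θ hN hxy, polyExp_congr ψ hN]
    rw [← sub_mul]
    exact hxy.mul_right _

theorem conj_resultantChar_mul_self {N u : F[X]} (hu : IsCoprime N u) :
    conj (resultantChar θ N u) * resultantChar θ N u = 1 := by
  rw [Complex.conj_mul', norm_resultantChar_of_isCoprime θ hu]
  simp

variable {θ} in
/-- `χ_N` is primitive when `N` is square-free and `θ ≠ 1`: its Fourier transform is the conjugate
character times the Gauss sum, also at `h` not coprime to `N`, where both sides vanish. -/
theorem twistedGaussSum_eq (hθ : θ ≠ 1) {N : F[X]} (hN : N.Monic) (hsq : Squarefree N) (h : F[X]) :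
    twistedGaussSum ψ θ N h = conj (resultantChar θ N h) * twistedGaussSum ψ θ N 1 := by
  by_cases hc : IsCoprime N h
  · have h1 := twistedGaussSum_mul_unit ψ θ hN hc 1
    rw [mul_one] at h1
    rw [← h1, ← mul_assoc, conj_resultantChar_mul_self θ hc, one_mul]
  · rw [(resultantChar_eq_zero_iff θ hN).2 hc, map_zero, zero_mul]
    obtain ⟨P, hPm, hP, ⟨Q, rfl⟩, ⟨h', rfl⟩⟩ := exists_monic_irreducible_dvd hc
    have hQm : Q.Monic := hPm.of_mul_monic_left hN
    have hPQ : IsCoprime P Q := by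
      rw [hP.coprime_iff_not_dvd]
      rintro ⟨R, rfl⟩
      exact hP.not_isUnit (hsq P ⟨R, by ring⟩)
    obtain ⟨u₀, hu₀, hne⟩ := exists_resultantChar_ne_one hθ hP hPm
    obtain ⟨a, b, hab⟩ := hPQ
    -- `u ≡ u₀ mod P` and `u ≡ 1 mod Q`, so that `u h ≡ h mod P Q` while `χ(u) ≠ 1`
    set u := u₀ * (b * Q) + a * P with hu
    have huP : resultantChar θ P u = resultantChar θ P u₀ :=
      resultantChar_congr θ hPm ⟨a - u₀ * a, by rw [hu]; linear_combination u₀ * hab⟩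
    have huQ : resultantChar θ Q u = 1 := by
      rw [← resultantChar_one_right θ (N := Q)]
      exact resultantChar_congr θ hQm ⟨u₀ * b - b, by rw [hu]; linear_combination hab⟩
    have huN : resultantChar θ (P * Q) u = resultantChar θ P u₀ := by
      rw [resultantChar_mul_left θ hPm hQm, huP, huQ, mul_one]
    have hcop : IsCoprime (P * Q) u := by
      by_contra hc'
      rw [← resultantChar_eq_zero_iff θ hN, huN, resultantChar_eq_zero_iff θ hPm] at hc'
      exact hc' hu₀
    have h1 := twistedGaussSum_mul_unit ψ θ hN hcop (P * h')
    have h2 : twistedGaussSum ψ θ (P * Q) (u * (P * h')) =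
        twistedGaussSum ψ θ (P * Q) (P * h') := by
      refine Finset.sum_congr rfl fun x _ => ?_
      congr 1
      refine polyExp_congr ψ hN ⟨x * h' * (u₀ * b - b), ?_⟩
      rw [hu]; linear_combination x * P * h' * hab
    rw [h2, huN] at h1
    have h3 : (resultantChar θ P u₀ - 1) * twistedGaussSum ψ θ (P * Q) (P * h') = 0 := by
      linear_combination h1
    exact (mul_eq_zero.1 h3).resolve_left (sub_ne_zero.2 hne)

variable {ψ θ} in
/-- The Gauss sum has absolute value `q ^ (deg N / 2)`, by Parseval's identity for `χ_N`. -/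
theorem normSq_twistedGaussSum_one (hψ : ψ ≠ 1) (hθ : θ ≠ 1) {N : F[X]} (hN : N.Monic)
    (hsq : Squarefree N) :
    ‖twistedGaussSum ψ θ N 1‖ ^ 2 = (Fintype.card F : ℝ) ^ N.natDegree := by
  classical
  set L := polyLT F N.natDegree
  have h1 : ∑ h ∈ L, twistedGaussSum ψ θ N h * conj (twistedGaussSum ψ θ N h) =
      (Fintype.card F : ℂ) ^ N.natDegree *
        ∑ x ∈ L, resultantChar θ N x * conj (resultantChar θ N x) := by
    have h2 : ∀ h, twistedGaussSum ψ θ N h * conj (twistedGaussSum ψ θ N h) =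
        ∑ x ∈ L, ∑ y ∈ L, resultantChar θ N x * conj (resultantChar θ N y) *
          polyExp ψ N (h * (x - y)) := by
      intro h
      rw [twistedGaussSum, map_sum, Finset.sum_mul_sum]
      refine Finset.sum_congr rfl fun x _ => Finset.sum_congr rfl fun y _ => ?_
      rw [map_mul, ← polyExp_neg, show h * (x - y) = x * h + -(y * h) by ring, polyExp_add]
      ring
    simp_rw [h2]
    rw [Finset.sum_comm, Finset.mul_sum]
    refine Finset.sum_congr rfl fun x hx => ?_
    rw [Finset.sum_comm, ← Finset.sum_subset (Finset.singleton_subset_iff.2 hx)]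
    · rw [Finset.sum_singleton, ← Finset.mul_sum, sum_polyExp_mul_sub hψ hN hx hx, if_pos rfl]
      ring
    · intro y hy hyx
      rw [← Finset.mul_sum, sum_polyExp_mul_sub hψ hN hx hy, if_neg, mul_zero]
      rintro rfl
      simp at hyx
  have h3 : ∑ h ∈ L, twistedGaussSum ψ θ N h * conj (twistedGaussSum ψ θ N h) =
      (‖twistedGaussSum ψ θ N 1‖ : ℂ) ^ 2 *
        ∑ x ∈ L, resultantChar θ N x * conj (resultantChar θ N x) := by
    rw [Finset.mul_sum]
    refine Finset.sum_congr rfl fun h _ => ?_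
    rw [twistedGaussSum_eq ψ hθ hN hsq h, map_mul, Complex.conj_conj, ← Complex.mul_conj']
    ring
  rw [h1] at h3
  have h4 : ∑ x ∈ L, resultantChar θ N x * conj (resultantChar θ N x) ≠ 0 := by
    simp_rw [Complex.mul_conj']
    norm_cast
    refine (Finset.sum_pos' (fun _ _ => by positivity) ⟨1 %ₘ N, modByMonic_mem_polyLT hN _, ?_⟩).ne'
    rw [resultantChar_modByMonic θ hN, resultantChar_one_right]
    simp
  have h5 := mul_right_cancel₀ h4 h3
  exact_mod_cast h5.symm

variable {ψ θ} in
/-- Fourier inversion for `χ_N`. -/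
theorem card_pow_mul_resultantChar (hψ : ψ ≠ 1) (hθ : θ ≠ 1) {N : F[X]} (hN : N.Monic)
    (hsq : Squarefree N) (M : F[X]) :
    (Fintype.card F : ℂ) ^ N.natDegree * resultantChar θ N M =
      twistedGaussSum ψ θ N 1 * ∑ h ∈ polyLT F N.natDegree,
        conj (resultantChar θ N h) * polyExp ψ N (-(M * h)) := by
  classical
  have h1 : twistedGaussSum ψ θ N 1 * ∑ h ∈ polyLT F N.natDegree,
        conj (resultantChar θ N h) * polyExp ψ N (-(M * h)) =
      ∑ x ∈ polyLT F N.natDegree, resultantChar θ N x *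
        ∑ h ∈ polyLT F N.natDegree, polyExp ψ N (h * (x - M %ₘ N)) := by
    rw [Finset.mul_sum]
    simp_rw [Finset.mul_sum]
    rw [Finset.sum_comm]
    refine Finset.sum_congr rfl fun h _ => ?_
    rw [← mul_assoc, mul_comm (twistedGaussSum ψ θ N 1), ← twistedGaussSum_eq ψ hθ hN hsq,
      twistedGaussSum, Finset.sum_mul]
    refine Finset.sum_congr rfl fun x _ => ?_
    rw [mul_assoc, ← polyExp_add]
    congr 1
    refine polyExp_congr ψ hN ?_
    obtain ⟨c, hc⟩ := dvd_modByMonic_sub M N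
    exact ⟨h * c, by linear_combination h * hc⟩
  rw [h1, ← Finset.sum_subset (Finset.singleton_subset_iff.2 (modByMonic_mem_polyLT hN M))]
  · rw [Finset.sum_singleton, sum_polyExp_mul_sub hψ hN (modByMonic_mem_polyLT hN M)
      (modByMonic_mem_polyLT hN M), if_pos rfl, resultantChar_modByMonic θ hN, mul_comm]
  · intro x hx hne
    rw [sum_polyExp_mul_sub hψ hN hx (modByMonic_mem_polyLT hN M), if_neg, mul_zero]
    rintro rfl
    simp at hne

/-- Chinese remainder theorem: `y / B - x / A = (y A - x B) / (A B)` runs through all proper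
fractions with denominator `A B` as `x` and `y` run through the residues modulo `A` and `B`. -/
theorem sum_polyLT_cross {A B : F[X]} (hA : A.Monic) (hB : B.Monic) (hAB : IsCoprime A B)
    (G : F[X] → ℂ) :
    ∑ p ∈ polyLT F A.natDegree ×ˢ polyLT F B.natDegree, G (p.2 * A - p.1 * B) =
      ∑ h ∈ polyLT F (A.natDegree + B.natDegree), G h := by
  have hmem : ∀ p ∈ polyLT F A.natDegree ×ˢ polyLT F B.natDegree,
      p.2 * A - p.1 * B ∈ polyLT F (A.natDegree + B.natDegree) := by
    intro p hp
    rw [Finset.mem_product] at hp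
    refine sub_mem_polyLT ?_ ?_
    · have := mul_mem_polyLT hA hp.2
      rwa [add_comm] at this
    · exact mul_mem_polyLT hB hp.1
  have hinj : Set.InjOn (fun p : F[X] × F[X] => p.2 * A - p.1 * B)
      (polyLT F A.natDegree ×ˢ polyLT F B.natDegree : Finset (F[X] × F[X])) := by
    rintro ⟨x, y⟩ hp ⟨x', y'⟩ hp' h
    simp only [Finset.coe_product, Set.mem_prod, Finset.mem_coe] at hp hp'
    simp only at h
    have h1 : x = x' := eq_of_mem_polyLT_of_dvd_sub hA hp.1 hp'.1
      (hAB.dvd_of_dvd_mul_right ⟨y - y', by linear_combination -h⟩)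
    have h2 : y = y' := eq_of_mem_polyLT_of_dvd_sub hB hp.2 hp'.2
      (hAB.symm.dvd_of_dvd_mul_right ⟨x - x', by linear_combination h⟩)
    rw [h1, h2]
  refine Finset.sum_nbij _ hmem hinj ?_ (fun _ _ => rfl)
  refine Finset.surjOn_of_injOn_of_card_le _ (fun p hp => hmem p hp) hinj ?_
  rw [Finset.card_product, card_polyLT, card_polyLT, card_polyLT, pow_add]

/-- By reciprocity the cross terms `conj χ_A(B)` and `χ_B(A)` cancel, so that the dual character
is again `conj χ_A · χ_B`, without any twist depending on both `A` and `B`. -/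
theorem conj_resultantChar_mul_resultantChar_cross (hθ1 : θ (-1) = 1) {A B : F[X]}
    (hA : A.Monic) (hB : B.Monic) (hAB : IsCoprime A B) (x y : F[X]) :
    conj (resultantChar θ A (y * A - x * B)) * resultantChar θ B (y * A - x * B) =
      conj (resultantChar θ A x) * resultantChar θ B y := by
  have h1 : resultantChar θ A (y * A - x * B) = resultantChar θ A x * resultantChar θ A B := by
    rw [← resultantChar_mul_right θ hA, ← resultantChar_neg_right θ hθ1 hA (x * B)]
    exact resultantChar_congr θ hA ⟨y, by ring⟩
  have h2 : resultantChar θ B (y * A - x * B) = resultantChar θ B y * resultantChar θ A B := by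
    rw [resultantChar_comm hθ1 A B, ← resultantChar_mul_right θ hB]
    exact resultantChar_congr θ hB ⟨-x, by ring⟩
  rw [h1, h2, map_mul]
  linear_combination conj (resultantChar θ A x) * resultantChar θ B y *
    conj_resultantChar_mul_self θ hAB

variable {ψ θ} in
/-- Poisson summation for `χ_A · conj χ_B` over the ball `{deg M < k}`. The Gauss sum of the
product character separates into a factor depending on `A` and one depending on `B`. -/
theorem poisson_resultantChar (hψ : ψ ≠ 1) (hθ : θ ≠ 1) (hθ1 : θ (-1) = 1) {A B : F[X]}
    (hA : A.Monic) (hB : B.Monic) (hAs : Squarefree A) (hBs : Squarefree B)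
    (hAB : IsCoprime A B) (k : ℕ) :
    (Fintype.card F : ℂ) ^ (A.natDegree + B.natDegree) *
      ∑ M ∈ polyLT F k, resultantChar θ A M * conj (resultantChar θ B M) =
    (Fintype.card F : ℂ) ^ k * (twistedGaussSum ψ θ A 1 * conj (twistedGaussSum ψ θ B 1)) *
      ∑ h ∈ polyLT F (A.natDegree + B.natDegree - k),
        conj (resultantChar θ A h) * resultantChar θ B h := by
  classical
  set a := A.natDegree
  set b := B.natDegree
  set f : F[X] → ℂ := fun h => conj (resultantChar θ A h) * resultantChar θ B h
  set gA := twistedGaussSum ψ θ A 1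
  set gB := twistedGaussSum ψ θ B 1
  have hdeg : (A * B).natDegree = a + b := hA.natDegree_mul hB
  have hcoef : ∀ p : F[X] × F[X], f (p.2 * A - p.1 * B) =
      conj (resultantChar θ A p.1) * resultantChar θ B p.2 := fun p =>
    conj_resultantChar_mul_resultantChar_cross θ hθ1 hA hB hAB p.1 p.2
  have hexp : ∀ (M : F[X]) (p : F[X] × F[X]), polyExp ψ A (-(M * p.1)) *
      conj (polyExp ψ B (-(M * p.2))) = polyExp ψ (A * B) (M * (p.2 * A - p.1 * B)) := by
    intro M p
    rw [← polyExp_neg, neg_neg, ← polyExp_mul_right ψ hA hB, ← polyExp_mul_right ψ hB hA,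
      mul_comm B A, ← polyExp_add]
    congr 1
    ring
  calc (Fintype.card F : ℂ) ^ (a + b) *
      ∑ M ∈ polyLT F k, resultantChar θ A M * conj (resultantChar θ B M)
      = ∑ M ∈ polyLT F k, ((Fintype.card F : ℂ) ^ a * resultantChar θ A M) *
          conj ((Fintype.card F : ℂ) ^ b * resultantChar θ B M) := by
        rw [Finset.mul_sum]
        refine Finset.sum_congr rfl fun M _ => ?_
        rw [map_mul, map_pow, Complex.conj_natCast, pow_add]
        ring
    _ = ∑ M ∈ polyLT F k, gA * conj gB * ∑ p ∈ polyLT F a ×ˢ polyLT F b,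
          f (p.2 * A - p.1 * B) * polyExp ψ (A * B) (M * (p.2 * A - p.1 * B)) := by
        refine Finset.sum_congr rfl fun M _ => ?_
        rw [card_pow_mul_resultantChar hψ hθ hA hAs M, card_pow_mul_resultantChar hψ hθ hB hBs M]
        rw [map_mul, mul_mul_mul_comm]
        congr 1
        rw [map_sum, Finset.sum_mul_sum, Finset.sum_product]
        refine Finset.sum_congr rfl fun x _ => Finset.sum_congr rfl fun y _ => ?_
        rw [hcoef (x, y), ← hexp M (x, y), map_mul, Complex.conj_conj]
        ring
    _ = gA * conj gB * ∑ h ∈ polyLT F (a + b), f h *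
          ∑ M ∈ polyLT F k, polyExp ψ (A * B) (M * h) := by
        rw [← Finset.mul_sum, Finset.sum_comm]
        congr 1
        simp_rw [← Finset.mul_sum]
        exact sum_polyLT_cross hA hB hAB fun h => f h * ∑ M ∈ polyLT F k, polyExp ψ (A * B) (M * h)
    _ = gA * conj gB * ∑ h ∈ polyLT F (a + b - k), f h * (Fintype.card F : ℂ) ^ k := by
        congr 1
        rw [← Finset.sum_subset (polyLT_mono (Nat.sub_le (a + b) k))]
        · refine Finset.sum_congr rfl fun h hh => ?_
          rw [sum_polyExp_mul hψ (hA.mul hB) k (by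
            rw [hdeg]; exact polyLT_mono (Nat.sub_le (a + b) k) hh), hdeg, if_pos hh]
        · intro h hh hh'
          rw [sum_polyExp_mul hψ (hA.mul hB) k (by rwa [hdeg]), hdeg, if_neg hh', mul_zero]
    _ = _ := by
        rw [← Finset.sum_mul]
        ring

end

/-! ### Duality, Möbius inversion and the divisor bound -/

section
open ComplexConjugate UniqueFactorizationMonoid

/-- The duality principle: a matrix and its transpose have the same operator norm. -/
theorem sum_normSq_sum_le_of_dual {ι κ : Type*} (S : Finset ι) (T : Finset κ) (a : ι → κ → ℂ)
    {X : ℝ} (hX : 0 ≤ X)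
    (h : ∀ x : κ → ℂ, ∑ i ∈ S, ‖∑ j ∈ T, x j * a i j‖ ^ 2 ≤ X * ∑ j ∈ T, ‖x j‖ ^ 2)
    (y : ι → ℂ) : ∑ j ∈ T, ‖∑ i ∈ S, y i * a i j‖ ^ 2 ≤ X * ∑ i ∈ S, ‖y i‖ ^ 2 := by
  set c : κ → ℂ := fun j => ∑ i ∈ S, y i * a i j
  set Z := ∑ j ∈ T, ‖c j‖ ^ 2 with hZ
  have h1 : (Z : ℂ) = ∑ i ∈ S, y i * ∑ j ∈ T, conj (c j) * a i j := by
    rw [hZ]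
    push_cast
    simp_rw [Finset.mul_sum]
    rw [Finset.sum_comm]
    refine Finset.sum_congr rfl fun j _ => ?_
    rw [← Complex.conj_mul']
    nth_rw 2 [show c j = ∑ i ∈ S, y i * a i j from rfl]
    rw [Finset.mul_sum]
    exact Finset.sum_congr rfl fun i _ => by ring
  have hZ0 : 0 ≤ Z := Finset.sum_nonneg fun _ _ => by positivity
  have hY0 : 0 ≤ ∑ i ∈ S, ‖y i‖ ^ 2 := Finset.sum_nonneg fun _ _ => by positivity
  have h2 : Z ≤ ∑ i ∈ S, ‖y i‖ * ‖∑ j ∈ T, conj (c j) * a i j‖ := by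
    have h3 : Z = ‖(Z : ℂ)‖ := by rw [Complex.norm_real, Real.norm_of_nonneg hZ0]
    rw [h3, h1]
    exact (norm_sum_le _ _).trans (Finset.sum_le_sum fun i _ => (norm_mul _ _).le)
  have h3 : Z ^ 2 ≤ (∑ i ∈ S, ‖y i‖ ^ 2) * (X * Z) := by
    calc Z ^ 2 ≤ (∑ i ∈ S, ‖y i‖ * ‖∑ j ∈ T, conj (c j) * a i j‖) ^ 2 := by gcongr
      _ ≤ (∑ i ∈ S, ‖y i‖ ^ 2) * ∑ i ∈ S, ‖∑ j ∈ T, conj (c j) * a i j‖ ^ 2 :=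
        Finset.sum_mul_sq_le_sq_mul_sq _ _ _
      _ ≤ (∑ i ∈ S, ‖y i‖ ^ 2) * (X * Z) := by
        gcongr
        simpa using h fun j => conj (c j)
  rcases hZ0.eq_or_lt with h0 | h0
  · rw [← h0]
    positivity
  · nlinarith

section
variable {F : Type*} [Field F]

open Classical in
/-- The set of monic irreducible divisors of `N`. -/
noncomputable def primeDivisors (N : F[X]) : Finset F[X] := (normalizedFactors N).toFinset

theorem mem_primeDivisors {N P : F[X]} (hN : N ≠ 0) :
    P ∈ primeDivisors N ↔ Irreducible P ∧ P.Monic ∧ P ∣ N := by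
  classical
  rw [primeDivisors, Multiset.mem_toFinset, mem_normalizedFactors_iff' hN]
  refine ⟨fun h => ⟨h.1, ?_, h.2.2⟩, fun h => ⟨h.1, h.2.1.normalize_eq_self, h.2.2⟩⟩
  rw [← h.2.1]
  exact monic_normalize h.1.ne_zero

theorem prod_primeDivisors {N : F[X]} (hN : N.Monic) (hs : Squarefree N) :
    ∏ P ∈ primeDivisors N, P = N := by
  classical
  rw [primeDivisors, Finset.prod_eq_multiset_prod, Multiset.toFinset_val,
    ((squarefree_iff_nodup_normalizedFactors hN.ne_zero).1 hs).dedup, Multiset.map_id',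
    prod_normalizedFactors_eq hN.ne_zero, hN.normalize_eq_self]

theorem primeDivisors_prod {S : Finset F[X]} (hS : ∀ P ∈ S, Irreducible P ∧ P.Monic) :
    primeDivisors (∏ P ∈ S, P) = S := by
  ext P
  rw [mem_primeDivisors (Finset.prod_ne_zero_iff.2 fun P hP => (hS P hP).1.ne_zero)]
  constructor
  · rintro ⟨h1, h2, h3⟩
    obtain ⟨Q, hQ, hPQ⟩ := (h1.prime.dvd_finsetProd_iff _).1 h3
    have := eq_of_monic_of_associated h2 (hS Q hQ).2 (h1.associated_of_dvd (hS Q hQ).1 hPQ)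
    rwa [this]
  · intro hP
    exact ⟨(hS P hP).1, (hS P hP).2, Finset.dvd_prod_of_mem _ hP⟩

/-- The Möbius function on square-free polynomials. -/
noncomputable def polyMoebius (E : F[X]) : ℝ := (-1) ^ (primeDivisors E).card

theorem abs_polyMoebius (E : F[X]) : |polyMoebius E| = 1 := by
  simp [polyMoebius]

theorem exists_monic_gcd {G : F[X]} (hG : G.Monic) (M : F[X]) :
    ∃ J : F[X], J.Monic ∧ (∀ E, E ∣ J ↔ E ∣ G ∧ E ∣ M) ∧ (J = 1 ↔ IsCoprime G M) := by
  classical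
  set J := normalize (EuclideanDomain.gcd G M)
  have h0 : EuclideanDomain.gcd G M ≠ 0 := fun h =>
    hG.ne_zero (EuclideanDomain.gcd_eq_zero_iff.1 h).1
  have hJ : ∀ E, E ∣ J ↔ E ∣ G ∧ E ∣ M := fun E => by
    rw [dvd_normalize_iff]
    exact ⟨fun h => ⟨h.trans (EuclideanDomain.gcd_dvd_left _ _),
      h.trans (EuclideanDomain.gcd_dvd_right _ _)⟩, fun h => EuclideanDomain.dvd_gcd h.1 h.2⟩
  refine ⟨J, monic_normalize h0, hJ, ?_⟩
  rw [← EuclideanDomain.gcd_isUnit_iff, ← normalize_eq_one]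

end

variable (F : Type*) [Field F] [Fintype F]

open Classical in
/-- The finite set of monic square-free polynomials of degree at most `n`. -/
noncomputable def monicSquarefreeLE (n : ℕ) : Finset F[X] :=
  (polyLT F (n + 1)).filter fun E => E.Monic ∧ Squarefree E

variable {F}

theorem mem_monicSquarefreeLE {n : ℕ} {E : F[X]} :
    E ∈ monicSquarefreeLE F n ↔ E.Monic ∧ Squarefree E ∧ E.natDegree ≤ n := by
  classical
  rw [monicSquarefreeLE, Finset.mem_filter, mem_polyLT]
  constructor
  · rintro ⟨h1, h2, h3⟩
    rw [degree_eq_natDegree h2.ne_zero, Nat.cast_lt] at h1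
    exact ⟨h2, h3, by omega⟩
  · rintro ⟨h1, h2, h3⟩
    rw [degree_eq_natDegree h1.ne_zero, Nat.cast_lt]
    exact ⟨by omega, h1, h2⟩

theorem monicSquarefree_subset_polyLT {n k : ℕ} (h : n < k) : monicSquarefree F n ⊆ polyLT F k := by
  intro f hf
  rw [mem_monicSquarefree] at hf
  rw [mem_polyLT, degree_eq_natDegree hf.1.ne_zero, Nat.cast_lt]
  omega

open Classical in
/-- The monic divisors of a monic square-free `N` correspond to the sets of its prime divisors. -/
theorem sum_filter_dvd_eq_sum_powerset {n : ℕ} {N : F[X]} (hN : N ∈ monicSquarefreeLE F n)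
    (f : Finset F[X] → ℝ) :
    ∑ E ∈ (monicSquarefreeLE F n).filter (· ∣ N), f (primeDivisors E) =
      ∑ S ∈ (primeDivisors N).powerset, f S := by
  obtain ⟨hm, hs, hd⟩ := mem_monicSquarefreeLE.1 hN
  have hirr : ∀ S ∈ (primeDivisors N).powerset, ∀ P ∈ S, Irreducible P ∧ P.Monic :=
    fun S hS P hP => by
      have := (mem_primeDivisors hm.ne_zero).1 (Finset.mem_powerset.1 hS hP)
      exact ⟨this.1, this.2.1⟩
  refine Finset.sum_nbij' primeDivisors (fun S => ∏ P ∈ S, P) ?_ ?_ ?_ ?_ (fun _ _ => rfl)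
  · intro E hE
    obtain ⟨hE, hdvd⟩ := Finset.mem_filter.1 hE
    rw [Finset.mem_powerset]
    intro P hP
    rw [mem_primeDivisors (mem_monicSquarefreeLE.1 hE).1.ne_zero] at hP
    rw [mem_primeDivisors hm.ne_zero]
    exact ⟨hP.1, hP.2.1, hP.2.2.trans hdvd⟩
  · intro S hS
    have hdvd : ∏ P ∈ S, P ∣ N := by
      conv_rhs => rw [← prod_primeDivisors hm hs]
      exact Finset.prod_dvd_prod_of_subset _ _ _ (Finset.mem_powerset.1 hS)
    rw [Finset.mem_filter, mem_monicSquarefreeLE]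
    exact ⟨⟨monic_prod_of_monic _ _ fun P hP => (hirr S hS P hP).2, hs.squarefree_of_dvd hdvd,
      (natDegree_le_of_dvd hdvd hm.ne_zero).trans hd⟩, hdvd⟩
  · intro E hE
    obtain ⟨hE, -⟩ := Finset.mem_filter.1 hE
    obtain ⟨h1, h2, -⟩ := mem_monicSquarefreeLE.1 hE
    exact prod_primeDivisors h1 h2
  · intro S hS
    exact primeDivisors_prod (hirr S hS)

open Classical in
/-- Möbius inversion: `∑_{E ∣ N} μ(E) = [N = 1]` for `N` monic and square-free. -/
theorem sum_polyMoebius {n : ℕ} {N : F[X]} (hN : N ∈ monicSquarefreeLE F n) :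
    ∑ E ∈ (monicSquarefreeLE F n).filter (· ∣ N), polyMoebius E = if N = 1 then 1 else 0 := by
  obtain ⟨hm, hs, hd⟩ := mem_monicSquarefreeLE.1 hN
  have h1 := sum_filter_dvd_eq_sum_powerset hN fun S => (-1) ^ S.card
  have h2 := Finset.sum_powerset_neg_one_pow_card (x := primeDivisors N)
  have h3 : ∑ S ∈ (primeDivisors N).powerset, (-1 : ℝ) ^ S.card =
      ((if primeDivisors N = ∅ then 1 else 0 : ℤ) : ℝ) := by
    rw [← h2]; push_cast; rfl
  have h4 : primeDivisors N = ∅ ↔ N = 1 := by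
    constructor
    · intro h
      rw [← prod_primeDivisors hm hs, h, Finset.prod_empty]
    · rintro rfl
      simp [primeDivisors]
  unfold polyMoebius
  rw [h1, h3]
  simp only [h4]
  split_ifs <;> simp

open Classical in
theorem card_filter_dvd {n : ℕ} {N : F[X]} (hN : N ∈ monicSquarefreeLE F n) :
    ((monicSquarefreeLE F n).filter (· ∣ N)).card = 2 ^ (primeDivisors N).card := by
  have h := sum_filter_dvd_eq_sum_powerset hN fun _ => 1
  simp only [Finset.sum_const, Finset.card_powerset, nsmul_eq_mul, mul_one] at h
  exact_mod_cast h

open Classical in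
/-- The divisor bound `τ(N) ≤ K q ^ (ε deg N)`: each prime divisor contributes a factor `2`, which
is at most `q ^ (ε deg P)` except for the finitely many `P` of small degree. -/
theorem exists_card_filter_dvd_le (F : Type*) [Field F] [Fintype F] {ε : ℝ} (hε : 0 < ε) :
    ∃ K : ℝ, 1 ≤ K ∧ ∀ (n : ℕ) (N : F[X]), N ∈ monicSquarefree F n →
      (((monicSquarefreeLE F n).filter (· ∣ N)).card : ℝ) ≤
        K * (Fintype.card F : ℝ) ^ (ε * n) := by
  have hq : (1 : ℝ) < Fintype.card F := by exact_mod_cast Fintype.one_lt_card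
  have hq0 : (0 : ℝ) < Fintype.card F := by positivity
  obtain ⟨L, hL⟩ : ∃ L : ℕ, (2 : ℝ) ≤ (Fintype.card F : ℝ) ^ (ε * L) := by
    obtain ⟨L, hL⟩ := pow_unbounded_of_one_lt 2 (Real.one_lt_rpow hq hε)
    exact ⟨L, by rw [Real.rpow_mul hq0.le, Real.rpow_natCast]; exact hL.le⟩
  refine ⟨2 ^ (polyLT F L).card, one_le_pow₀ (by norm_num), fun n N hN => ?_⟩
  obtain ⟨hm, hs, rfl⟩ := mem_monicSquarefree.1 hN
  rw [card_filter_dvd (mem_monicSquarefreeLE.2 ⟨hm, hs, le_rfl⟩)]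
  push_cast
  have hdeg : (N.natDegree : ℝ) = ∑ P ∈ primeDivisors N, (P.natDegree : ℝ) := by
    conv_lhs => rw [← prod_primeDivisors hm hs]
    rw [natDegree_prod _ _ fun P hP => ((mem_primeDivisors hm.ne_zero).1 hP).1.ne_zero]
    push_cast
    rfl
  calc (2 : ℝ) ^ (primeDivisors N).card = ∏ P ∈ primeDivisors N, 2 := by simp
    _ ≤ ∏ P ∈ primeDivisors N, (if P ∈ polyLT F L then 2 else 1) *
          (Fintype.card F : ℝ) ^ (ε * P.natDegree) := by
        refine Finset.prod_le_prod (fun _ _ => by norm_num) fun P hP => ?_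
        split_ifs with h
        · have := Real.one_le_rpow hq.le (show 0 ≤ ε * (P.natDegree : ℝ) by positivity)
          linarith
        · rw [mem_polyLT, degree_eq_natDegree ((mem_primeDivisors hm.ne_zero).1 hP).1.ne_zero,
            Nat.cast_lt, not_lt] at h
          rw [one_mul]
          refine hL.trans (Real.rpow_le_rpow_of_exponent_le hq.le ?_)
          gcongr
    _ = 2 ^ ((primeDivisors N).filter (· ∈ polyLT F L)).card *
          (Fintype.card F : ℝ) ^ (ε * N.natDegree) := by
        rw [Finset.prod_mul_distrib, hdeg, Finset.mul_sum, Real.rpow_sum_of_pos hq0]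
        congr 1
        rw [Finset.prod_ite]
        simp
    _ ≤ _ := by
        gcongr
        · norm_num
        · intro P hP
          exact (Finset.mem_filter.1 hP).2

variable (θ : MulChar F ℂ)

/-- `LargeSieveBound θ n k X` says that `X` bounds the squared operator norm of the matrix
`χ_N(M)`, with `N` monic square-free of degree `n` and `M` any polynomial of degree less than `k`.
Summing over a whole ball in `M` makes the bound monotone in `k` and Poisson summation exact. -/
def LargeSieveBound (n k : ℕ) (X : ℝ) : Prop :=
  ∀ lam : F[X] → ℂ, ∑ M ∈ polyLT F k,
    ‖∑ N ∈ monicSquarefree F n, lam N * resultantChar θ N M‖ ^ 2 ≤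
      X * ∑ N ∈ monicSquarefree F n, ‖lam N‖ ^ 2

variable {θ}

theorem LargeSieveBound.anti {n k k' : ℕ} {X : ℝ} (h : LargeSieveBound θ n k' X) (hk : k ≤ k') :
    LargeSieveBound θ n k X := fun lam =>
  (Finset.sum_le_sum_of_subset_of_nonneg (polyLT_mono hk) fun _ _ _ => by positivity).trans (h lam)

theorem LargeSieveBound.mono {n k : ℕ} {X X' : ℝ} (h : LargeSieveBound θ n k X) (hX : X ≤ X') :
    LargeSieveBound θ n k X' := fun lam =>
  (h lam).trans (mul_le_mul_of_nonneg_right hX (Finset.sum_nonneg fun _ _ => by positivity))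

theorem LargeSieveBound.sum_monicSquarefree {n k m : ℕ} {X : ℝ} (h : LargeSieveBound θ n k X)
    (hm : m < k) (lam : F[X] → ℂ) :
    ∑ M ∈ monicSquarefree F m, ‖∑ N ∈ monicSquarefree F n, lam N * resultantChar θ N M‖ ^ 2 ≤
      X * ∑ N ∈ monicSquarefree F n, ‖lam N‖ ^ 2 :=
  (Finset.sum_le_sum_of_subset_of_nonneg (monicSquarefree_subset_polyLT hm)
    fun _ _ _ => by positivity).trans (h lam)

/-- By duality and reciprocity, a bound for the moduli of degree `n` gives one for sums with roles
exchanged, where the moduli have degree `m < k` and the outer sum is over degree `n`. -/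
theorem LargeSieveBound.dual (hθ1 : θ (-1) = 1) {n k m : ℕ} {X : ℝ} (h : LargeSieveBound θ n k X)
    (hX : 0 ≤ X) (hm : m < k) (lam : F[X] → ℂ) :
    ∑ N ∈ monicSquarefree F n, ‖∑ M ∈ monicSquarefree F m, lam M * resultantChar θ M N‖ ^ 2 ≤
      X * ∑ M ∈ monicSquarefree F m, ‖lam M‖ ^ 2 := by
  have := sum_normSq_sum_le_of_dual (monicSquarefree F m) (monicSquarefree F n)
    (fun M N => resultantChar θ N M) hX (h.sum_monicSquarefree hm) lam
  simpa only [resultantChar_comm hθ1] using this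

theorem monicSquarefree_zero : monicSquarefree F 0 = {1} := by
  ext f
  rw [mem_monicSquarefree, Finset.mem_singleton]
  constructor
  · rintro ⟨h1, -, h2⟩
    exact h1.natDegree_eq_zero.1 h2
  · rintro rfl
    simp

theorem largeSieveBound_zero_left (k : ℕ) : LargeSieveBound θ 0 k ((Fintype.card F : ℝ) ^ k) := by
  intro lam
  simp [monicSquarefree_zero, resultantChar_one_left, card_polyLT]

theorem largeSieveBound_zero_right (n : ℕ) : LargeSieveBound θ n 0 1 := by
  intro lam
  rcases Nat.eq_zero_or_pos n with rfl | hn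
  · simpa using largeSieveBound_zero_left 0 lam
  · rw [polyLT_zero, Finset.sum_singleton, Finset.sum_eq_zero]
    · simp only [norm_zero, ne_eq, OfNat.ofNat_ne_zero, not_false_eq_true, zero_pow, one_mul]
      exact Finset.sum_nonneg fun _ _ => by positivity
    · intro N hN
      obtain ⟨h1, -, h2⟩ := mem_monicSquarefree.1 hN
      rw [(resultantChar_eq_zero_iff θ h1).2, mul_zero]
      rw [isCoprime_zero_right, h1.isUnit_iff]
      rintro rfl
      simp at h2
      omega

end

/-! ### The Gram matrix of the characters -/

section
open ComplexConjugate
variable {F : Type*} [Field F] [Fintype F] {ψ : AddChar F ℂ} {θ : MulChar F ℂ}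

open Classical in
theorem sum_filter_dvd_polyLT {E : F[X]} (hE : E.Monic) {k : ℕ} (hk : E.natDegree ≤ k)
    (f : F[X] → ℂ) :
    ∑ M ∈ (polyLT F k).filter (E ∣ ·), f M = ∑ M ∈ polyLT F (k - E.natDegree), f (E * M) := by
  symm
  refine Finset.sum_nbij (fun M => E * M) ?_ ?_ ?_ (fun _ _ => rfl)
  · intro M hM
    have := mul_mem_polyLT hE hM
    rw [Nat.sub_add_cancel hk, mul_comm] at this
    exact Finset.mem_filter.2 ⟨this, dvd_mul_right _ _⟩
  · intro M _ M' _ h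
    exact mul_left_cancel₀ hE.ne_zero h
  · intro M hM
    obtain ⟨hM, M', rfl⟩ := Finset.mem_filter.1 (Finset.mem_coe.1 hM)
    refine ⟨M', ?_, rfl⟩
    by_cases h0 : M' = 0
    · rw [h0]; exact zero_mem_polyLT _
    rw [Finset.mem_coe, mem_polyLT, degree_eq_natDegree h0, Nat.cast_lt]
    rw [mem_polyLT, degree_eq_natDegree (mul_ne_zero hE.ne_zero h0), Nat.cast_lt,
      natDegree_mul hE.ne_zero h0] at hM
    omega

variable (ψ θ) in
/-- The coefficient of the modulus `A` at the dual variable `h` after Poisson summation over the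
multiples of `E`. -/
noncomputable def dualCoeff (E A h : F[X]) : ℂ :=
  resultantChar θ A E * twistedGaussSum ψ θ A 1 * conj (resultantChar θ A h)

open Classical in
/-- Poisson summation over the multiples `M` of `E` with `deg M < k`. -/
theorem sum_filter_dvd_resultantChar (hψ : ψ ≠ 1) (hθ : θ ≠ 1) (hθ1 : θ (-1) = 1) {A B E : F[X]}
    (hA : A.Monic) (hB : B.Monic) (hAs : Squarefree A) (hBs : Squarefree B) (hAB : IsCoprime A B)
    {s : ℕ} (hAd : A.natDegree = s) (hBd : B.natDegree = s) (hE : E.Monic) {k : ℕ}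
    (hk : E.natDegree ≤ k) :
    ∑ M ∈ (polyLT F k).filter (E ∣ ·), resultantChar θ A M * conj (resultantChar θ B M) =
      (Fintype.card F : ℂ) ^ (k - E.natDegree) / (Fintype.card F : ℂ) ^ (2 * s) *
        ∑ h ∈ polyLT F (2 * s - (k - E.natDegree)),
          dualCoeff ψ θ E A h * conj (dualCoeff ψ θ E B h) := by
  have hq : (Fintype.card F : ℂ) ^ (2 * s) ≠ 0 :=
    pow_ne_zero _ (Nat.cast_ne_zero.2 Fintype.card_ne_zero)
  have hp := poisson_resultantChar hψ hθ hθ1 hA hB hAs hBs hAB (k - E.natDegree)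
  rw [hAd, hBd, ← two_mul] at hp
  rw [sum_filter_dvd_polyLT hE hk, div_mul_eq_mul_div, eq_div_iff hq]
  have h1 : ∀ M, resultantChar θ A (E * M) * conj (resultantChar θ B (E * M)) =
      resultantChar θ A E * conj (resultantChar θ B E) *
        (resultantChar θ A M * conj (resultantChar θ B M)) := by
    intro M
    rw [resultantChar_mul_right θ hA, resultantChar_mul_right θ hB, map_mul]
    ring
  have h2 : ∀ h, dualCoeff ψ θ E A h * conj (dualCoeff ψ θ E B h) =
      resultantChar θ A E * conj (resultantChar θ B E) *
        (twistedGaussSum ψ θ A 1 * conj (twistedGaussSum ψ θ B 1)) *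
        (conj (resultantChar θ A h) * resultantChar θ B h) := by
    intro h
    simp only [dualCoeff, map_mul, Complex.conj_conj]
    ring
  simp_rw [h1, h2]
  rw [← Finset.mul_sum, ← Finset.mul_sum]
  linear_combination resultantChar θ A E * conj (resultantChar θ B E) * hp

theorem resultantChar_mul_conj_self {G M : F[X]} (hG : G.Monic) [Decidable (IsCoprime G M)] :
    resultantChar θ G M * conj (resultantChar θ G M) = if IsCoprime G M then 1 else 0 := by
  split_ifs with h
  · rw [mul_comm, conj_resultantChar_mul_self θ h]
  · rw [(resultantChar_eq_zero_iff θ hG).2 h, zero_mul]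

open Classical in
/-- Möbius inversion for the condition `(G, M) = 1`. -/
theorem ite_isCoprime_eq_sum_polyMoebius {n : ℕ} {G : F[X]} (hG : G ∈ monicSquarefreeLE F n)
    (M : F[X]) :
    (if IsCoprime G M then (1 : ℝ) else 0) =
      ∑ E ∈ (monicSquarefreeLE F n).filter (· ∣ G), if E ∣ M then polyMoebius E else 0 := by
  obtain ⟨hm, hs, hd⟩ := mem_monicSquarefreeLE.1 hG
  obtain ⟨J, hJm, hJ, hJ1⟩ := exists_monic_gcd hm M
  have hJG : J ∣ G := ((hJ J).1 dvd_rfl).1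
  have h := sum_polyMoebius (n := n) (N := J) (mem_monicSquarefreeLE.2
    ⟨hJm, hs.squarefree_of_dvd hJG, (natDegree_le_of_dvd hJG hm.ne_zero).trans hd⟩)
  simp only [hJ1] at h
  rw [← h, ← Finset.sum_filter, Finset.filter_filter]
  simp only [hJ]

open Classical in
theorem sum_resultantChar_eq_sum_polyMoebius {A B G : F[X]} (hA : A.Monic) (hB : B.Monic)
    {n : ℕ} (hG : G ∈ monicSquarefreeLE F n) (k : ℕ) :
    ∑ M ∈ polyLT F k, resultantChar θ (G * A) M * conj (resultantChar θ (G * B) M) =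
      ∑ E ∈ (monicSquarefreeLE F n).filter (· ∣ G), (polyMoebius E : ℂ) *
        ∑ M ∈ (polyLT F k).filter (E ∣ ·), resultantChar θ A M * conj (resultantChar θ B M) := by
  have hm := (mem_monicSquarefreeLE.1 hG).1
  have h1 : ∀ M, resultantChar θ (G * A) M * conj (resultantChar θ (G * B) M) =
      ∑ E ∈ (monicSquarefreeLE F n).filter (· ∣ G), (polyMoebius E : ℂ) *
        if E ∣ M then resultantChar θ A M * conj (resultantChar θ B M) else 0 := by
    intro M
    rw [resultantChar_mul_left θ hm hA, resultantChar_mul_left θ hm hB, map_mul, mul_mul_mul_comm,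
      resultantChar_mul_conj_self hm]
    rw [show (if IsCoprime G M then (1 : ℂ) else 0) =
      ((if IsCoprime G M then (1 : ℝ) else 0 : ℝ) : ℂ) by split_ifs <;> simp,
      ite_isCoprime_eq_sum_polyMoebius hG M, Complex.ofReal_sum, Finset.sum_mul]
    refine Finset.sum_congr rfl fun E _ => ?_
    split_ifs <;> simp
  simp_rw [h1]
  rw [Finset.sum_comm]
  refine Finset.sum_congr rfl fun E _ => ?_
  rw [← Finset.mul_sum, Finset.sum_filter]

open Classical in
variable (ψ θ) in
/-- The coefficient of the modulus `N` in the dual sum attached to `(D, C, E)`. Here `D` is the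
greatest common divisor of two moduli `N₁`, `N₂`, the variable `C` comes from Möbius inversion of
the coprimality of `N₁ / D` and `N₂ / D`, and `E ∣ D` from that of `M` and `D`. -/
noncomputable def dualVector (D C E h N : F[X]) : ℂ :=
  if D * C ∣ N then dualCoeff ψ θ E (N / D) h else 0

variable (F) in
/-- The weight of the dual sum attached to `(D, C, E)`, for moduli of degree `n` and outer
variables of degree less than `k`. -/
noncomputable def dualWeight (n k : ℕ) (D C E : F[X]) : ℝ :=
  polyMoebius C * polyMoebius E * ((Fintype.card F : ℝ) ^ (k - E.natDegree) /
    (Fintype.card F : ℝ) ^ (2 * (n - D.natDegree)))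

theorem mem_monicSquarefreeLE_of_dvd {n : ℕ} {N D : F[X]} (hN : N ∈ monicSquarefreeLE F n)
    (hD : D.Monic) (h : D ∣ N) : D ∈ monicSquarefreeLE F n := by
  obtain ⟨hm, hs, hd⟩ := mem_monicSquarefreeLE.1 hN
  exact mem_monicSquarefreeLE.2 ⟨hD, hs.squarefree_of_dvd h,
    (natDegree_le_of_dvd h hm.ne_zero).trans hd⟩

open Classical in
/-- The Gram matrix `∑_M χ_{N₁}(M) conj χ_{N₂}(M)` as a weighted sum of Gram matrices of dual
vectors: the sum over `M` of a pair of moduli becomes a sum in which `N₁` and `N₂` are separated.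
-/
theorem sum_resultantChar_mul_conj_eq (hψ : ψ ≠ 1) (hθ : θ ≠ 1) (hθ1 : θ (-1) = 1) {n k : ℕ}
    (hnk : n ≤ k) {N₁ N₂ : F[X]} (h₁ : N₁ ∈ monicSquarefree F n) (h₂ : N₂ ∈ monicSquarefree F n) :
    ∑ M ∈ polyLT F k, resultantChar θ N₁ M * conj (resultantChar θ N₂ M) =
      ∑ D ∈ monicSquarefreeLE F n, ∑ E ∈ (monicSquarefreeLE F n).filter (· ∣ D),
        ∑ C ∈ monicSquarefreeLE F n, (dualWeight F n k D C E : ℂ) *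
          ∑ h ∈ polyLT F (2 * (n - D.natDegree) - (k - E.natDegree)),
            dualVector ψ θ D C E h N₁ * conj (dualVector ψ θ D C E h N₂) := by
  obtain ⟨hm₁, hs₁, hd₁⟩ := mem_monicSquarefree.1 h₁
  obtain ⟨hm₂, hs₂, hd₂⟩ := mem_monicSquarefree.1 h₂
  obtain ⟨G, hGm, hG, -⟩ := exists_monic_gcd hm₁ N₂
  obtain ⟨A, rfl⟩ := ((hG G).1 dvd_rfl).1
  obtain ⟨B, rfl⟩ := ((hG G).1 dvd_rfl).2
  have hA : A.Monic := hGm.of_mul_monic_left hm₁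
  have hB : B.Monic := hGm.of_mul_monic_left hm₂
  rw [hGm.natDegree_mul hA] at hd₁
  rw [hGm.natDegree_mul hB] at hd₂
  have hAB : IsCoprime A B := by
    by_contra hc
    obtain ⟨P, -, hP, hPA, hPB⟩ := exists_monic_irreducible_dvd hc
    have h := (hG (G * P)).2 ⟨mul_dvd_mul_left G hPA, mul_dvd_mul_left G hPB⟩
    exact hP.not_isUnit (isUnit_of_dvd_one ((mul_dvd_mul_iff_left hGm.ne_zero).1
      (by rwa [mul_one])))
  have hGmem : G ∈ monicSquarefreeLE F n := mem_monicSquarefreeLE.2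
    ⟨hGm, hs₁.squarefree_of_dvd (dvd_mul_right _ _), by omega⟩
  -- the sum over `C` vanishes unless `D` is the whole greatest common divisor `G`
  have hC : ∀ D ∈ monicSquarefreeLE F n, ∀ E h : F[X],
      ∑ C ∈ monicSquarefreeLE F n, (polyMoebius C : ℂ) *
        (dualVector ψ θ D C E h (G * A) * conj (dualVector ψ θ D C E h (G * B))) =
      if D = G then dualCoeff ψ θ E A h * conj (dualCoeff ψ θ E B h) else 0 := by
    intro D hD E h
    obtain ⟨hDm, -, -⟩ := mem_monicSquarefreeLE.1 hD
    have h1 : ∀ C, dualVector ψ θ D C E h (G * A) * conj (dualVector ψ θ D C E h (G * B)) =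
        if D * C ∣ G then dualCoeff ψ θ E (G * A / D) h * conj (dualCoeff ψ θ E (G * B / D) h)
        else 0 := by
      intro C
      unfold dualVector
      have := hG (D * C)
      by_cases hDC : D * C ∣ G
      · rw [if_pos hDC, if_pos (this.1 hDC).1, if_pos (this.1 hDC).2]
      · rw [if_neg hDC]
        by_cases hx : D * C ∣ G * A
        · rw [if_neg (c := D * C ∣ G * B) fun hy => hDC (this.2 ⟨hx, hy⟩), map_zero, mul_zero]
        · rw [if_neg hx, zero_mul]
    simp_rw [h1]
    by_cases hDG : D ∣ G
    · obtain ⟨J, rfl⟩ := hDG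
      have hJm : J.Monic := hDm.of_mul_monic_left hGm
      have hJ := sum_polyMoebius (mem_monicSquarefreeLE_of_dvd hGmem hJm (dvd_mul_left _ _))
      have hJ' := congrArg (fun x : ℝ => (x : ℂ)) hJ
      simp only [Complex.ofReal_sum] at hJ'
      have h2 : D = D * J ↔ J = 1 := by
        rw [eq_comm, mul_eq_left₀ hDm.ne_zero]
      simp only [mul_dvd_mul_iff_left hDm.ne_zero, h2, mul_ite, mul_zero]
      rw [← Finset.sum_filter, ← Finset.sum_mul, hJ']
      by_cases hJ1 : J = 1
      · subst hJ1
        simp only [mul_one, if_true, Complex.ofReal_one, one_mul]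
        rw [mul_div_cancel_left₀ _ hDm.ne_zero, mul_div_cancel_left₀ _ hDm.ne_zero]
      · simp [hJ1]
    · rw [if_neg (by rintro rfl; exact hDG dvd_rfl)]
      refine Finset.sum_eq_zero fun C _ => ?_
      rw [if_neg fun h => hDG ((dvd_mul_right _ _).trans h), mul_zero]
  rw [sum_resultantChar_eq_sum_polyMoebius hA hB hGmem, eq_comm, ← Finset.sum_subset
    (Finset.singleton_subset_iff.2 hGmem), Finset.sum_singleton]
  · refine Finset.sum_congr rfl fun E hE => ?_
    have hE := mem_monicSquarefreeLE.1 (Finset.mem_filter.1 hE).1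
    rw [sum_filter_dvd_resultantChar hψ hθ hθ1 hA hB
      (hs₁.squarefree_of_dvd (dvd_mul_left _ _)) (hs₂.squarefree_of_dvd (dvd_mul_left _ _)) hAB
      (s := n - G.natDegree) (by omega) (by omega) hE.1 (hE.2.2.trans hnk)]
    simp_rw [dualWeight, Finset.mul_sum]
    rw [Finset.sum_comm]
    refine Finset.sum_congr rfl fun h _ => ?_
    have := hC G hGmem E h
    rw [if_pos rfl] at this
    rw [← this]
    simp_rw [Finset.mul_sum]
    refine Finset.sum_congr rfl fun C _ => ?_
    push_cast
    ring
  · intro D hD hDG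
    refine Finset.sum_eq_zero fun E _ => ?_
    simp_rw [dualWeight, Finset.mul_sum]
    rw [Finset.sum_comm]
    refine Finset.sum_eq_zero fun h _ => ?_
    have := hC D hD E h
    rw [if_neg (by simpa using hDG)] at this
    rw [← mul_zero ((polyMoebius E : ℂ) * ((Fintype.card F : ℂ) ^ (k - E.natDegree) /
      (Fintype.card F : ℂ) ^ (2 * (n - D.natDegree)))), ← this, Finset.mul_sum]
    refine Finset.sum_congr rfl fun C _ => ?_
    push_cast
    ring

end

/-! ### The recursion from Poisson summation -/

section
open ComplexConjugate
variable {F : Type*} [Field F] [Fintype F] {ψ : AddChar F ℂ} {θ : MulChar F ℂ}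

open Classical in
theorem sum_filter_dvd_monicSquarefree {R : Type*} [AddCommMonoid R] {G : F[X]} (hG : G.Monic)
    {n r : ℕ} (hn : n = G.natDegree + r) (f : F[X] → R) :
    ∑ N ∈ (monicSquarefree F n).filter (G ∣ ·), f N =
      ∑ A ∈ (monicSquarefree F r).filter (G * · ∈ monicSquarefree F n), f (G * A) := by
  symm
  refine Finset.sum_nbij (fun A => G * A) ?_ ?_ ?_ (fun _ _ => rfl)
  · intro A hA
    exact Finset.mem_filter.2 ⟨(Finset.mem_filter.1 hA).2, dvd_mul_right _ _⟩
  · intro A _ A' _ h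
    exact mul_left_cancel₀ hG.ne_zero h
  · intro N hN
    obtain ⟨hN, A, rfl⟩ := Finset.mem_filter.1 (Finset.mem_coe.1 hN)
    refine ⟨A, Finset.mem_coe.2 (Finset.mem_filter.2 ⟨?_, hN⟩), rfl⟩
    obtain ⟨h1, h2, h3⟩ := mem_monicSquarefree.1 hN
    have hA : A.Monic := hG.of_mul_monic_left h1
    rw [hG.natDegree_mul hA] at h3
    exact mem_monicSquarefree.2 ⟨hA, h2.squarefree_of_dvd (dvd_mul_left _ _), by omega⟩

open Classical in
/-- The dual sum attached to `(D, C, E)` is a sum of the same kind over the moduli `A = N / (D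
C)`; the factor `q ^ s` is the squared absolute value of the Gauss sums. -/
theorem LargeSieveBound.sum_dualVector_le (hψ : ψ ≠ 1) (hθ : θ ≠ 1) {n s r κ : ℕ} {X : ℝ}
    (h : LargeSieveBound θ r κ X) (hX : 0 ≤ X) {D C : F[X]} (hD : D.Monic) (hC : C.Monic)
    (hs : n = D.natDegree + s) (hr : s = C.natDegree + r) (E : F[X]) (lam : F[X] → ℂ) :
    ∑ h ∈ polyLT F κ, ‖∑ N ∈ monicSquarefree F n, lam N * dualVector ψ θ D C E h N‖ ^ 2 ≤
      X * ((Fintype.card F : ℝ) ^ s *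
        ∑ N ∈ (monicSquarefree F n).filter (D * C ∣ ·), ‖lam N‖ ^ 2) := by
  have hDC : n = (D * C).natDegree + r := by rw [hD.natDegree_mul hC]; omega
  set T := (monicSquarefree F r).filter (D * C * · ∈ monicSquarefree F n) with hT
  set y : F[X] → ℂ := fun A => if A ∈ T then conj (lam (D * C * A) *
    resultantChar θ (C * A) E * twistedGaussSum ψ θ (C * A) 1) else 0 with hy
  have h1 : ∀ h, ∑ N ∈ monicSquarefree F n, lam N * dualVector ψ θ D C E h N =
      conj (resultantChar θ C h * ∑ A ∈ monicSquarefree F r, y A * resultantChar θ A h) := by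
    intro h
    simp only [dualVector, mul_ite, mul_zero]
    rw [← Finset.sum_filter, sum_filter_dvd_monicSquarefree (hD.mul hC) hDC, map_mul, map_sum,
      Finset.mul_sum]
    simp only [hy, ite_mul, zero_mul, apply_ite conj, map_zero, mul_ite, mul_zero]
    rw [← Finset.sum_filter, Finset.filter_mem_eq_inter,
      Finset.inter_eq_right.2 (Finset.filter_subset _ _)]
    refine Finset.sum_congr rfl fun A hA => ?_
    have hAm := (mem_monicSquarefree.1 (Finset.mem_filter.1 hA).1).1
    rw [mul_assoc D C A, mul_div_cancel_left₀ _ hD.ne_zero, dualCoeff,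
      resultantChar_mul_left θ hC hAm h]
    simp only [map_mul, Complex.conj_conj]
    ring
  have h2 : ∑ A ∈ monicSquarefree F r, ‖y A‖ ^ 2 ≤ (Fintype.card F : ℝ) ^ s *
      ∑ N ∈ (monicSquarefree F n).filter (D * C ∣ ·), ‖lam N‖ ^ 2 := by
    have h3 : ∑ A ∈ monicSquarefree F r, ‖y A‖ ^ 2 = ∑ A ∈ T, ‖y A‖ ^ 2 := by
      symm
      refine Finset.sum_subset (Finset.filter_subset _ _) fun A _ hA => ?_
      simp [hy, hA]
    rw [h3, sum_filter_dvd_monicSquarefree (hD.mul hC) hDC, Finset.mul_sum]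
    refine Finset.sum_le_sum fun A hA => ?_
    have hA1 := mem_monicSquarefree.1 (Finset.mem_filter.1 hA).1
    have hA2 := mem_monicSquarefree.1 (Finset.mem_filter.1 hA).2
    have hsq : Squarefree (C * A) := hA2.2.1.squarefree_of_dvd ⟨D, by ring⟩
    have hg := normSq_twistedGaussSum_one hψ hθ (hC.mul hA1.1) hsq
    rw [hC.natDegree_mul hA1.1, hA1.2.2, ← hr] at hg
    simp only [hy, if_pos hA]
    rw [RCLike.norm_conj, norm_mul, norm_mul, mul_pow, mul_pow, hg]
    have h4 : ‖resultantChar θ (C * A) E‖ ^ 2 ≤ 1 :=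
      pow_le_one₀ (norm_nonneg _) (norm_resultantChar_le_one θ _ _)
    have h5 : 0 ≤ ‖lam (D * C * A)‖ ^ 2 * (Fintype.card F : ℝ) ^ s := by positivity
    nlinarith
  calc _ ≤ ∑ h ∈ polyLT F κ, ‖∑ A ∈ monicSquarefree F r, y A * resultantChar θ A h‖ ^ 2 := by
        refine Finset.sum_le_sum fun g _ => ?_
        rw [h1, RCLike.norm_conj, norm_mul, mul_pow]
        exact mul_le_of_le_one_left (by positivity)
          (pow_le_one₀ (norm_nonneg _) (norm_resultantChar_le_one θ _ _))
    _ ≤ X * ∑ A ∈ monicSquarefree F r, ‖y A‖ ^ 2 := h y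
    _ ≤ _ := mul_le_mul_of_nonneg_left h2 hX

open Classical in
theorem sum_normSq_eq_sum_dualVector (hψ : ψ ≠ 1) (hθ : θ ≠ 1) (hθ1 : θ (-1) = 1) {n k : ℕ}
    (hnk : n ≤ k) (lam : F[X] → ℂ) :
    ∑ M ∈ polyLT F k, ‖∑ N ∈ monicSquarefree F n, lam N * resultantChar θ N M‖ ^ 2 =
      ∑ D ∈ monicSquarefreeLE F n, ∑ E ∈ (monicSquarefreeLE F n).filter (· ∣ D),
        ∑ C ∈ monicSquarefreeLE F n, dualWeight F n k D C E *
          ∑ h ∈ polyLT F (2 * (n - D.natDegree) - (k - E.natDegree)),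
            ‖∑ N ∈ monicSquarefree F n, lam N * dualVector ψ θ D C E h N‖ ^ 2 := by
  set H := monicSquarefree F n
  have key : ∀ (S : Finset F[X]) (v : F[X] → F[X] → ℂ),
      ((∑ M ∈ S, ‖∑ N ∈ H, lam N * v N M‖ ^ 2 : ℝ) : ℂ) =
        ∑ p ∈ H ×ˢ H, lam p.1 * conj (lam p.2) * ∑ M ∈ S, v p.1 M * conj (v p.2 M) := by
    intro S v
    push_cast
    simp_rw [← Complex.mul_conj', map_sum, Finset.sum_mul_sum, Finset.mul_sum]
    rw [Finset.sum_comm, Finset.sum_product]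
    refine Finset.sum_congr rfl fun N₁ _ => ?_
    rw [Finset.sum_comm]
    refine Finset.sum_congr rfl fun N₂ _ => Finset.sum_congr rfl fun M _ => ?_
    rw [map_mul]
    ring
  apply Complex.ofReal_injective
  rw [key, Finset.sum_congr rfl fun p hp => by
    rw [sum_resultantChar_mul_conj_eq hψ hθ hθ1 hnk (Finset.mem_product.1 hp).1
      (Finset.mem_product.1 hp).2]]
  rw [Complex.ofReal_sum, Finset.sum_congr rfl fun p _ => Finset.mul_sum _ _ _, Finset.sum_comm]
  refine Finset.sum_congr rfl fun D _ => ?_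
  rw [Complex.ofReal_sum, Finset.sum_congr rfl fun p _ => Finset.mul_sum _ _ _, Finset.sum_comm]
  refine Finset.sum_congr rfl fun E _ => ?_
  rw [Complex.ofReal_sum, Finset.sum_congr rfl fun p _ => Finset.mul_sum _ _ _, Finset.sum_comm]
  refine Finset.sum_congr rfl fun C _ => ?_
  rw [Complex.ofReal_mul, key _ (fun N h => dualVector ψ θ D C E h N), Finset.mul_sum]
  refine Finset.sum_congr rfl fun p _ => ?_
  ring

open Classical in
theorem sum_sum_filter_dvd_le {n : ℕ} {T : ℝ}
    (hT : ∀ N ∈ monicSquarefree F n, (((monicSquarefreeLE F n).filter (· ∣ N)).card : ℝ) ≤ T)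
    (a : F[X] → ℝ) (ha : ∀ N, 0 ≤ a N) :
    ∑ D ∈ monicSquarefreeLE F n, ∑ E ∈ (monicSquarefreeLE F n).filter (· ∣ D),
        ∑ C ∈ monicSquarefreeLE F n, ∑ N ∈ (monicSquarefree F n).filter (D * C ∣ ·), a N ≤
      T ^ 3 * ∑ N ∈ monicSquarefree F n, a N := by
  set H := monicSquarefreeLE F n
  have h1 : ∀ D ∈ H, ∑ E ∈ H.filter (· ∣ D), ∑ C ∈ H,
      ∑ N ∈ (monicSquarefree F n).filter (D * C ∣ ·), a N ≤
      ∑ E ∈ H, ∑ C ∈ H, ∑ N ∈ monicSquarefree F n,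
        if D ∣ N ∧ E ∣ N ∧ C ∣ N then a N else 0 := by
    intro D _
    rw [Finset.sum_filter]
    refine Finset.sum_le_sum fun E _ => ?_
    split_ifs with hED
    · refine Finset.sum_le_sum fun C _ => ?_
      rw [Finset.sum_filter]
      refine Finset.sum_le_sum fun N _ => ?_
      split_ifs with h2 h3 h3
      · exact le_rfl
      · exact absurd ⟨(dvd_mul_right _ _).trans h2, hED.trans ((dvd_mul_right _ _).trans h2),
          (dvd_mul_left _ _).trans h2⟩ h3
      · exact ha N
      · exact le_rfl
    · exact Finset.sum_nonneg fun C _ => Finset.sum_nonneg fun N _ => by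
        split_ifs
        exacts [ha N, le_rfl]
  refine (Finset.sum_le_sum h1).trans ?_
  have h2 : ∑ D ∈ H, ∑ E ∈ H, ∑ C ∈ H, ∑ N ∈ monicSquarefree F n,
      (if D ∣ N ∧ E ∣ N ∧ C ∣ N then a N else 0) =
      ∑ N ∈ monicSquarefree F n, ((H.filter (· ∣ N)).card : ℝ) ^ 3 * a N := by
    rw [Finset.sum_congr rfl fun D _ => Finset.sum_congr rfl fun _ _ => Finset.sum_comm,
      Finset.sum_congr rfl fun D _ => Finset.sum_comm, Finset.sum_comm]
    refine Finset.sum_congr rfl fun N _ => ?_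
    have h3 : ∀ D E C : F[X], (if D ∣ N ∧ E ∣ N ∧ C ∣ N then a N else 0) =
        (if D ∣ N then 1 else 0) * ((if E ∣ N then 1 else 0) *
          ((if C ∣ N then 1 else 0) * a N)) := by
      intro D E C
      by_cases hD : D ∣ N <;> by_cases hE : E ∣ N <;> by_cases hC : C ∣ N <;> simp [hD, hE, hC]
    simp_rw [h3, ← Finset.mul_sum, ← Finset.sum_mul, Finset.sum_boole]
    ring
  rw [h2, Finset.mul_sum]
  refine Finset.sum_le_sum fun N hN => mul_le_mul_of_nonneg_right ?_ (ha N)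
  exact pow_le_pow_left₀ (by positivity) (hT N hN) 3

open Classical in
/-- The recursion given by Poisson summation. Writing `s = n - deg D`, the dual moduli have degree
`r = s - deg C` and the dual variable has degree less than `2 s - (k - e)`, `e = deg E`. -/
theorem largeSieveBound_of_dual (hθ : θ ≠ 1) (hθ1 : θ (-1) = 1) {n k : ℕ} (hnk : n ≤ k) {T Y : ℝ}
    (hT : ∀ N ∈ monicSquarefree F n, (((monicSquarefreeLE F n).filter (· ∣ N)).card : ℝ) ≤ T)
    (hY : 0 ≤ Y)
    (hrec : ∀ s r e, s ≤ n → r ≤ s → e ≤ n - s → ∃ X, 0 ≤ X ∧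
      LargeSieveBound θ r (2 * s - (k - e)) X ∧
      (Fintype.card F : ℝ) ^ (k - e) / (Fintype.card F : ℝ) ^ s * X ≤ Y) :
    LargeSieveBound θ n k (T ^ 3 * Y) := by
  intro lam
  obtain ⟨ψ, hψ⟩ : ∃ ψ : AddChar F ℂ, ψ ≠ 1 := by
    obtain ⟨ψ, h⟩ := AddChar.exists_apply_ne_zero.2 (one_ne_zero (α := F))
    exact ⟨ψ, by rintro rfl; exact h rfl⟩
  have hq : (0 : ℝ) < Fintype.card F := by exact_mod_cast Fintype.card_pos
  rw [sum_normSq_eq_sum_dualVector hψ hθ hθ1 hnk, mul_comm _ Y, mul_assoc]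
  refine le_trans ?_ (mul_le_mul_of_nonneg_left
    (sum_sum_filter_dvd_le hT (fun N => ‖lam N‖ ^ 2) fun N => by positivity) hY)
  rw [Finset.mul_sum]
  refine Finset.sum_le_sum fun D hD => ?_
  rw [Finset.mul_sum]
  refine Finset.sum_le_sum fun E hE => ?_
  rw [Finset.mul_sum]
  refine Finset.sum_le_sum fun C hC => ?_
  obtain ⟨hE, hED⟩ := Finset.mem_filter.1 hE
  rw [mem_monicSquarefreeLE] at hD hE hC
  have hS : 0 ≤ ∑ N ∈ (monicSquarefree F n).filter (D * C ∣ ·), ‖lam N‖ ^ 2 :=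
    Finset.sum_nonneg fun _ _ => by positivity
  by_cases hdeg : D.natDegree + C.natDegree ≤ n
  · obtain ⟨X, hX, hb, hXY⟩ := hrec (n - D.natDegree) (n - D.natDegree - C.natDegree) E.natDegree
      (by omega) (by omega) (by
        have := natDegree_le_of_dvd hED hD.1.ne_zero
        omega)
    have h1 := hb.sum_dualVector_le hψ hθ hX hD.1 hC.1 (n := n) (s := n - D.natDegree) (by omega)
      (by omega) E lam
    have h2 : |dualWeight F n k D C E| = (Fintype.card F : ℝ) ^ (k - E.natDegree) /
        (Fintype.card F : ℝ) ^ (2 * (n - D.natDegree)) := by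
      rw [dualWeight, abs_mul, abs_mul, abs_polyMoebius, abs_polyMoebius, one_mul, one_mul,
        abs_of_pos (by positivity)]
    refine (mul_le_mul_of_nonneg_right (le_abs_self _)
      (Finset.sum_nonneg fun _ _ => by positivity)).trans ?_
    rw [h2]
    refine (mul_le_mul_of_nonneg_left h1 (by positivity)).trans ?_
    refine le_trans (le_of_eq ?_) (mul_le_mul_of_nonneg_right hXY hS)
    rw [two_mul, pow_add]
    field_simp
  · rw [Finset.sum_eq_zero, mul_zero]
    · positivity
    · intro h _
      rw [Finset.sum_eq_zero]
      · simp
      · intro N hN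
        obtain ⟨h1, -, h3⟩ := mem_monicSquarefree.1 hN
        rw [dualVector, if_neg, mul_zero]
        intro hd
        have := natDegree_le_of_dvd hd h1.ne_zero
        rw [hD.1.natDegree_mul hC.1] at this
        omega

end

/-! ### Decomposition into a square-free part, a square and a cube -/

section
variable {F : Type*} [Field F]

theorem exists_eq_pow_mul_of_powerFree {r : ℕ} (hr : r ≠ 0) {M : F[X]} (hM : M ≠ 0) :
    ∃ c M' : F[X], M = c ^ r * M' ∧ ∀ x, x ^ r ∣ M' → IsUnit x := by
  induction h : M.natDegree using Nat.strong_induction_on generalizing M with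
  | _ d ih =>
    by_cases hx : ∀ x, x ^ r ∣ M → IsUnit x
    · exact ⟨1, M, by simp, hx⟩
    push Not at hx
    obtain ⟨x, ⟨M₁, rfl⟩, hxu⟩ := hx
    have hM₁ : M₁ ≠ 0 := right_ne_zero_of_mul hM
    have hx0 : x ≠ 0 := by
      rintro rfl
      simp [hr] at hM
    have hdx : 0 < x.natDegree := by
      by_contra! h0
      exact hxu (isUnit_iff_degree_eq_zero.2 (by
        rw [degree_eq_natDegree hx0]; simpa using h0))
    have hlt : M₁.natDegree < d := by
      rw [← h, natDegree_mul (pow_ne_zero _ hx0) hM₁, natDegree_pow]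
      have := Nat.mul_pos (Nat.pos_of_ne_zero hr) hdx
      omega
    obtain ⟨c, M', rfl, hM'⟩ := ih _ hlt hM₁ rfl
    exact ⟨x * c, M', by rw [mul_pow]; ring, hM'⟩

/-- Every nonzero polynomial is a constant times `a b² c³` with `a` and `b` monic and square-free.
-/
theorem exists_eq_mul_sq_mul_cube {M : F[X]} (hM : M ≠ 0) :
    ∃ (u : F) (a b c : F[X]), a.Monic ∧ Squarefree a ∧ b.Monic ∧ Squarefree b ∧
      M = C u * a * b ^ 2 * c ^ 3 := by
  obtain ⟨c, M', rfl, hM'⟩ := exists_eq_pow_mul_of_powerFree three_ne_zero hM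
  have hM'0 : M' ≠ 0 := right_ne_zero_of_mul hM
  obtain ⟨b, a, rfl, ha⟩ := exists_eq_pow_mul_of_powerFree two_ne_zero hM'0
  have ha0 : a ≠ 0 := right_ne_zero_of_mul hM'0
  have hb0 : b ≠ 0 := by
    rintro rfl
    simp at hM'0
  have hla : a.leadingCoeff ≠ 0 := leadingCoeff_ne_zero.2 ha0
  have hlb : b.leadingCoeff ≠ 0 := leadingCoeff_ne_zero.2 hb0
  have hC : ∀ x : F, x ≠ 0 → C x⁻¹ * C x = 1 := fun x hx => by
    rw [← C_mul, inv_mul_cancel₀ hx, C_1]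
  have hdiv : ∀ (x : F) (f : F[X]), x ≠ 0 → f * C x⁻¹ ∣ f := fun x f hx =>
    ⟨C x, by rw [mul_assoc, hC x hx, mul_one]⟩
  have has : Squarefree a := fun x hx => ha x (by rwa [sq])
  -- `x ^ 2 ∣ b` would imply `x ^ 4 ∣ b ^ 2 * a`, which is free of cubes
  have hbs : Squarefree b := fun x hx => hM' x (by
    obtain ⟨y, rfl⟩ := hx
    exact ⟨x * y ^ 2 * a, by ring⟩)
  refine ⟨a.leadingCoeff * b.leadingCoeff ^ 2, a * C a.leadingCoeff⁻¹, b * C b.leadingCoeff⁻¹, c,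
    monic_mul_leadingCoeff_inv ha0, has.squarefree_of_dvd (hdiv _ _ hla),
    monic_mul_leadingCoeff_inv hb0, hbs.squarefree_of_dvd (hdiv _ _ hlb), ?_⟩
  rw [C_mul, C_pow]
  have h1 := hC _ hla
  have h2 := hC _ hlb
  linear_combination (exp := 1) (-(c ^ 3 * b ^ 2 * a * (1 + C b.leadingCoeff⁻¹ * C b.leadingCoeff) *
    (C a.leadingCoeff⁻¹ * C a.leadingCoeff))) * h2 - c ^ 3 * b ^ 2 * a * h1

theorem sum_le_sum_comp_of_surj {α β : Type*} (s : Finset α) (t : Finset β) (g : β → α) {f : α → ℝ}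
    (hf : ∀ x, 0 ≤ f x) (h : ∀ x ∈ s, ∃ y ∈ t, g y = x) : ∑ x ∈ s, f x ≤ ∑ y ∈ t, f (g y) := by
  classical
  rcases s.eq_empty_or_nonempty with rfl | ⟨x₀, hx₀⟩
  · simpa using Finset.sum_nonneg fun y _ => hf (g y)
  have : Nonempty β := ⟨(h x₀ hx₀).choose⟩
  choose! i hi using h
  have h1 : ∑ x ∈ s, f x = ∑ x ∈ s, f (g (i x)) :=
    Finset.sum_congr rfl fun x hx => by rw [(hi x hx).2]
  rw [h1, ← Finset.sum_image (g := i) (s := s) (f := fun y => f (g y))]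
  · exact Finset.sum_le_sum_of_subset_of_nonneg
      (fun y hy => by obtain ⟨x, hx, rfl⟩ := Finset.mem_image.1 hy; exact (hi x hx).1)
      fun y _ _ => hf _
  · intro x hx y hy hxy
    rw [← (hi x hx).2, ← (hi y hy).2, hxy]

variable [Fintype F] {θ : MulChar F ℂ}

theorem card_monicSquarefree_le (n : ℕ) :
    ((monicSquarefree F n).card : ℝ) ≤ (Fintype.card F : ℝ) ^ (n + 1) := by
  have := Finset.card_le_card (monicSquarefree_subset_polyLT (F := F) (Nat.lt_succ_self n))
  rw [card_polyLT] at this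
  exact_mod_cast this

/-- Covering of the ball `{deg M < k}` by the products `u a b² c³`, sorted by the degrees of `a`,
`b` and `c`. The constant `u = 0` takes care of `M = 0`. -/
theorem sum_polyLT_le_sum_cubic {k : ℕ} (hk : 0 < k) {f : F[X] → ℝ} (hf : ∀ x, 0 ≤ f x) {Z : ℝ}
    (hZ : ∀ (u : F) (α β γ : ℕ), α + 2 * β + 3 * γ < k →
      ∑ c ∈ polyLT F (γ + 1), ∑ a ∈ monicSquarefree F α, ∑ b ∈ monicSquarefree F β,
        f (C u * a * b ^ 2 * c ^ 3) ≤ Z) (hZ0 : 0 ≤ Z) :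
    ∑ M ∈ polyLT F k, f M ≤ Fintype.card F * (k : ℝ) ^ 3 * Z := by
  classical
  set T : Finset (F × ℕ × ℕ × ℕ) := Finset.univ ×ˢ
    ((Finset.range k ×ˢ Finset.range k ×ˢ Finset.range k).filter
      fun t => t.1 + 2 * t.2.1 + 3 * t.2.2 < k) with hT
  set P : F × ℕ × ℕ × ℕ → Finset (F[X] × F[X] × F[X]) := fun t =>
    polyLT F (t.2.2.2 + 1) ×ˢ monicSquarefree F t.2.1 ×ˢ monicSquarefree F t.2.2.1 with hP
  set g : (Σ _ : F × ℕ × ℕ × ℕ, F[X] × F[X] × F[X]) → F[X] := fun y =>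
    C y.1.1 * y.2.2.1 * y.2.2.2 ^ 2 * y.2.1 ^ 3 with hg
  have hsurj : ∀ M ∈ polyLT F k, ∃ y ∈ T.sigma P, g y = M := by
    intro M hM
    by_cases h0 : M = 0
    · refine ⟨⟨(0, 0, 0, 0), (1, 1, 1)⟩, ?_, by simp [hg, h0]⟩
      simp [hT, hP, hk, monicSquarefree_zero, mem_polyLT]
    · obtain ⟨u, a, b, c, ha, has, hb, hbs, rfl⟩ := exists_eq_mul_sq_mul_cube h0
      have hc0 : c ≠ 0 := by rintro rfl; simp at h0
      have hu0 : u ≠ 0 := by rintro rfl; simp at h0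
      have hdeg : (C u * a * b ^ 2 * c ^ 3).natDegree =
          a.natDegree + 2 * b.natDegree + 3 * c.natDegree := by
        rw [natDegree_mul (by simp [hu0, ha.ne_zero, hb.ne_zero]) (by simp [hc0]),
          natDegree_mul (by simp [hu0, ha.ne_zero]) (by simp [hb.ne_zero]),
          natDegree_C_mul hu0, natDegree_pow, natDegree_pow]
      rw [mem_polyLT, degree_eq_natDegree h0, Nat.cast_lt, hdeg] at hM
      refine ⟨⟨(u, a.natDegree, b.natDegree, c.natDegree), (c, a, b)⟩, ?_, rfl⟩
      simp only [hT, hP, Finset.mem_sigma, Finset.mem_product, Finset.mem_univ, Finset.mem_filter,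
        Finset.mem_range, true_and, mem_monicSquarefree, mem_polyLT, degree_eq_natDegree hc0,
        Nat.cast_lt]
      refine ⟨⟨⟨by omega, by omega, by omega⟩, hM⟩, by omega, ⟨ha, has, trivial⟩, hb, hbs, trivial⟩
  refine (sum_le_sum_comp_of_surj _ _ g hf hsurj).trans ?_
  rw [Finset.sum_sigma]
  have h1 : ∀ t ∈ T, ∑ p ∈ P t, f (g ⟨t, p⟩) ≤ Z := by
    rintro ⟨u, α, β, γ⟩ ht
    have := hZ u α β γ (Finset.mem_filter.1 (Finset.mem_product.1 ht).2).2
    simp only [hP, Finset.sum_product]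
    exact this
  refine (Finset.sum_le_card_nsmul _ _ _ h1).trans ?_
  rw [nsmul_eq_mul]
  refine mul_le_mul_of_nonneg_right ?_ hZ0
  have h2 : T.card ≤ Fintype.card F * k ^ 3 := by
    rw [hT, Finset.card_product, Finset.card_univ]
    refine Nat.mul_le_mul_left _ ((Finset.card_filter_le _ _).trans ?_)
    simp only [Finset.card_product, Finset.card_range]
    exact le_of_eq (by ring)
  exact_mod_cast h2

/-- A sum over `M = u a b² c³` is bounded either through `χ_N(b)²`, with `u`, `a`, `c` fixed, or
through `χ_N(a)`, with `u`, `b`, `c` fixed; the fixed variables are absorbed into the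
coefficients. The choice may depend on the degrees `α`, `β`, `γ` of `a`, `b`, `c`. -/
theorem largeSieveBound_of_cubic {n k : ℕ} (hk : 0 < k) {Z : ℝ} (hZ0 : 0 ≤ Z)
    (h : ∀ α β γ : ℕ, α + 2 * β + 3 * γ < k →
      (∃ X : ℝ, (Fintype.card F : ℝ) ^ (α + 1) * (Fintype.card F : ℝ) ^ (γ + 1) * X ≤ Z ∧ 0 ≤ X ∧
        ∀ lam : F[X] → ℂ, ∑ b ∈ monicSquarefree F β,
          ‖∑ N ∈ monicSquarefree F n, lam N * resultantChar θ N b ^ 2‖ ^ 2 ≤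
            X * ∑ N ∈ monicSquarefree F n, ‖lam N‖ ^ 2) ∨
      (∃ X : ℝ, (Fintype.card F : ℝ) ^ (β + 1) * (Fintype.card F : ℝ) ^ (γ + 1) * X ≤ Z ∧ 0 ≤ X ∧
        ∀ lam : F[X] → ℂ, ∑ a ∈ monicSquarefree F α,
          ‖∑ N ∈ monicSquarefree F n, lam N * resultantChar θ N a‖ ^ 2 ≤
            X * ∑ N ∈ monicSquarefree F n, ‖lam N‖ ^ 2)) :
    LargeSieveBound θ n k (Fintype.card F * (k : ℝ) ^ 3 * Z) := by
  intro lam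
  set S := ∑ N ∈ monicSquarefree F n, ‖lam N‖ ^ 2
  have hS : 0 ≤ S := Finset.sum_nonneg fun _ _ => by positivity
  rw [mul_assoc]
  refine sum_polyLT_le_sum_cubic hk (fun _ => by positivity) ?_ (by positivity)
  have htwist : ∀ v : F[X], ∑ N ∈ monicSquarefree F n, ‖lam N * resultantChar θ N v‖ ^ 2 ≤ S := by
    intro v
    refine Finset.sum_le_sum fun N _ => ?_
    rw [norm_mul, mul_pow]
    exact mul_le_of_le_one_right (by positivity)
      (pow_le_one₀ (norm_nonneg _) (norm_resultantChar_le_one θ _ _))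
  intro u α β γ hlt
  have hcount : ∀ (X : ℝ) (δ : ℕ) (f : F[X] → F[X] → ℝ), 0 ≤ X → (∀ c a, f c a ≤ X * S) →
      (Fintype.card F : ℝ) ^ (δ + 1) * (Fintype.card F : ℝ) ^ (γ + 1) * X ≤ Z →
      ∑ c ∈ polyLT F (γ + 1), ∑ a ∈ monicSquarefree F δ, f c a ≤ Z * S := by
    intro X δ f hX hf hXZ
    calc ∑ c ∈ polyLT F (γ + 1), ∑ a ∈ monicSquarefree F δ, f c a
        ≤ ∑ c ∈ polyLT F (γ + 1), ∑ a ∈ monicSquarefree F δ, X * S :=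
          Finset.sum_le_sum fun c _ => Finset.sum_le_sum fun a _ => hf c a
      _ = (Fintype.card F : ℝ) ^ (γ + 1) * ((monicSquarefree F δ).card * (X * S)) := by
          simp [card_polyLT]
      _ ≤ (Fintype.card F : ℝ) ^ (γ + 1) * ((Fintype.card F : ℝ) ^ (δ + 1) * (X * S)) := by
          gcongr
          exact card_monicSquarefree_le δ
      _ = ((Fintype.card F : ℝ) ^ (δ + 1) * (Fintype.card F : ℝ) ^ (γ + 1) * X) * S := by ring
      _ ≤ Z * S := mul_le_mul_of_nonneg_right hXZ hS
  -- the inner sum is over `b` in the first case, over `a` in the second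
  rcases h α β γ hlt with ⟨X, hXZ, hX, hb⟩ | ⟨X, hXZ, hX, ha⟩
  · refine hcount X α _ hX (fun c a => ?_) hXZ
    refine le_trans (le_of_eq ?_) ((hb fun N => lam N * resultantChar θ N (C u * a * c ^ 3)).trans
      (mul_le_mul_of_nonneg_left (htwist _) hX))
    refine Finset.sum_congr rfl fun b _ => ?_
    congr 2
    refine Finset.sum_congr rfl fun N hN => ?_
    have hm := (mem_monicSquarefree.1 hN).1
    rw [mul_assoc (lam N), ← resultantChar_pow_right θ hm, ← resultantChar_mul_right θ hm]
    congr 2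
    ring
  · rw [Finset.sum_congr rfl fun c _ => Finset.sum_comm]
    refine hcount X β _ hX (fun c b => ?_) hXZ
    refine le_trans (le_of_eq ?_)
      ((ha fun N => lam N * resultantChar θ N (C u * b ^ 2 * c ^ 3)).trans
      (mul_le_mul_of_nonneg_left (htwist _) hX))
    refine Finset.sum_congr rfl fun a _ => ?_
    congr 2
    refine Finset.sum_congr rfl fun N hN => ?_
    have hm := (mem_monicSquarefree.1 hN).1
    rw [mul_assoc (lam N), ← resultantChar_mul_right θ hm]
    congr 2
    ring

end

/-! ### The large sieve inequality -/

section

theorem exists_pow_three_le_rpow {Q ε : ℝ} (hQ : 1 < Q) (hε : 0 < ε) :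
    ∃ K : ℝ, 1 ≤ K ∧ ∀ k : ℕ, (k : ℝ) ^ 3 ≤ K * Q ^ (ε * k) := by
  have hc : 0 < ε * Real.log Q / 3 := by have := Real.log_pos hQ; positivity
  set c := ε * Real.log Q / 3 with hc'
  refine ⟨max 1 ((1 / c) ^ 3), le_max_left _ _, fun k => ?_⟩
  have h1 : (k : ℝ) ≤ 1 / c * Real.exp (c * k) := by
    rw [one_div_mul_eq_div, le_div_iff₀ hc]
    have := Real.add_one_le_exp (c * k)
    linarith
  calc (k : ℝ) ^ 3 ≤ (1 / c * Real.exp (c * k)) ^ 3 := by gcongr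
    _ = (1 / c) ^ 3 * Q ^ (ε * k) := by
        rw [mul_pow, ← Real.exp_nat_mul, Real.rpow_def_of_pos (by linarith)]
        congr 2
        rw [hc']
        push_cast
        ring
    _ ≤ _ := by
        gcongr
        exact le_max_right _ _

variable {F : Type*} [Field F] [Fintype F] {θ : MulChar F ℂ}

theorem one_lt_card_real (F : Type*) [Field F] [Fintype F] : (1 : ℝ) < Fintype.card F := by
  exact_mod_cast Fintype.one_lt_card

open Classical in
/-- In the range `2 n ≤ k` the dual sums are reduced to `h = 0`, and the bound is `q ^ k` up to
the divisor function. -/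
theorem largeSieveBound_of_two_mul_le (hθ : θ ≠ 1) (hθ1 : θ (-1) = 1) {n k : ℕ} (hnk : 2 * n ≤ k)
    {T : ℝ}
    (hT : ∀ N ∈ monicSquarefree F n, (((monicSquarefreeLE F n).filter (· ∣ N)).card : ℝ) ≤ T) :
    LargeSieveBound θ n k (T ^ 3 * (Fintype.card F : ℝ) ^ k) := by
  have hQ := one_lt_card_real F
  refine largeSieveBound_of_dual hθ hθ1 (by omega) hT (by positivity) fun s r e hs hr he => ?_
  refine ⟨1, zero_le_one, ?_, ?_⟩
  · rw [show 2 * s - (k - e) = 0 by omega]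
    exact largeSieveBound_zero_right r
  · rw [mul_one]
    exact (div_le_self (by positivity) (one_le_pow₀ hQ.le)).trans
      (pow_le_pow_right₀ hQ.le (Nat.sub_le _ _))

/-- The bound `q ^ (s + κ / 3)` for a short outer sum, of length `κ ≤ s`. For `α ≤ β` the variable
`b` is summed with the characters of `θ²`, and `α + γ ≤ κ / 3`; for `β < α` the variable `a` is
summed, and `β + γ ≤ κ / 3`. In both cases duality exchanges the variable with the modulus. -/
theorem largeSieveBound_short (hθ1 : θ (-1) = 1) {r s κ : ℕ} (hrs : r ≤ s) (hκ0 : 0 < κ)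
    (hκs : κ ≤ s) {V : ℝ} (hV : 0 ≤ V)
    (hA : ∀ α < κ, LargeSieveBound θ α (s + 1) (V * ((Fintype.card F : ℝ) ^ (s : ℝ) +
      (Fintype.card F : ℝ) ^ (2 * ((α : ℝ) + s) / 3))))
    (hB : ∀ β, 2 * β < κ → LargeSieveBound (θ ^ 2) β (s + 1) (V * (Fintype.card F : ℝ) ^ (s : ℝ))) :
    LargeSieveBound θ r κ (Fintype.card F * (κ : ℝ) ^ 3 *
      (2 * (Fintype.card F : ℝ) ^ 2 * V * (Fintype.card F : ℝ) ^ ((s : ℝ) + κ / 3))) := by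
  have hQ := one_lt_card_real F
  have hQ0 : (0 : ℝ) < Fintype.card F := by linarith
  have hθ2 : (θ ^ 2) (-1) = 1 := by
    rw [MulChar.pow_apply' _ two_ne_zero, hθ1, one_pow]
  set Q : ℝ := (Fintype.card F : ℝ)
  refine largeSieveBound_of_cubic hκ0 (by positivity) fun α β γ hlt => ?_
  have hlt' : (α : ℝ) + 2 * β + 3 * γ ≤ κ := by exact_mod_cast hlt.le
  have hκs' : (κ : ℝ) ≤ s := by exact_mod_cast hκs
  have hexp : ∀ x y : ℕ, ∀ z : ℝ, Q ^ (x + 1) * Q ^ (y + 1) * Q ^ z =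
      Q ^ 2 * Q ^ ((x : ℝ) + y + z) := by
    intro x y z
    rw [Real.rpow_add hQ0, Real.rpow_add hQ0, Real.rpow_natCast, Real.rpow_natCast]
    ring
  rcases le_or_gt α β with hαβ | hαβ
  · left
    have hαβ' : (α : ℝ) ≤ β := by exact_mod_cast hαβ
    refine ⟨V * Q ^ (s : ℝ), ?_, by positivity, fun lam => ?_⟩
    · have h1 : Q ^ ((α : ℝ) + γ + s) ≤ Q ^ ((s : ℝ) + κ / 3) :=
        Real.rpow_le_rpow_of_exponent_le hQ.le (by linarith)
      calc Q ^ (α + 1) * Q ^ (γ + 1) * (V * Q ^ (s : ℝ))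
          = V * (Q ^ (α + 1) * Q ^ (γ + 1) * Q ^ (s : ℝ)) := by ring
        _ = V * (Q ^ 2 * Q ^ ((α : ℝ) + γ + s)) := by rw [hexp]
        _ ≤ V * (Q ^ 2 * Q ^ ((s : ℝ) + κ / 3)) := by gcongr
        _ ≤ 2 * Q ^ 2 * V * Q ^ ((s : ℝ) + κ / 3) := by
          have : 0 ≤ V * (Q ^ 2 * Q ^ ((s : ℝ) + κ / 3)) := by positivity
          linarith
    · have := (hB β (by omega)).dual hθ2 (by positivity) (m := r) (by omega) lam
      simpa only [resultantChar_pow θ 2 two_ne_zero] using this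
  · right
    have hαβ' : (β : ℝ) ≤ α := by exact_mod_cast hαβ.le
    refine ⟨V * (Q ^ (s : ℝ) + Q ^ (2 * ((α : ℝ) + s) / 3)), ?_, by positivity, fun lam => ?_⟩
    · have h1 : Q ^ ((β : ℝ) + γ + s) ≤ Q ^ ((s : ℝ) + κ / 3) :=
        Real.rpow_le_rpow_of_exponent_le hQ.le (by linarith)
      have h2 : Q ^ ((β : ℝ) + γ + 2 * ((α : ℝ) + s) / 3) ≤ Q ^ ((s : ℝ) + κ / 3) := by
        refine Real.rpow_le_rpow_of_exponent_le hQ.le ?_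
        have : (0 : ℝ) ≤ γ := Nat.cast_nonneg _
        have : (0 : ℝ) ≤ β := Nat.cast_nonneg _
        linarith
      calc Q ^ (β + 1) * Q ^ (γ + 1) * (V * (Q ^ (s : ℝ) + Q ^ (2 * ((α : ℝ) + s) / 3)))
          = V * (Q ^ (β + 1) * Q ^ (γ + 1) * Q ^ (s : ℝ) +
              Q ^ (β + 1) * Q ^ (γ + 1) * Q ^ (2 * ((α : ℝ) + s) / 3)) := by ring
        _ = V * (Q ^ 2 * Q ^ ((β : ℝ) + γ + s) +
              Q ^ 2 * Q ^ ((β : ℝ) + γ + 2 * ((α : ℝ) + s) / 3)) := by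
          rw [hexp, hexp]
        _ ≤ V * (Q ^ 2 * Q ^ ((s : ℝ) + κ / 3) + Q ^ 2 * Q ^ ((s : ℝ) + κ / 3)) := by gcongr
        _ = 2 * Q ^ 2 * V * Q ^ ((s : ℝ) + κ / 3) := by ring
    · exact (hA α (by omega)).dual hθ1 (by positivity) (m := r) (by omega) lam

/-- The bound in the range `k ≥ (1 + 1 / j) n`, by induction on `j`. Poisson summation leads to
outer variables of length `κ ≤ s + n - k` with moduli of degree at most `s`, and after
`largeSieveBound_short` to moduli of degree `α < κ` with outer length `s + 1`. These satisfy the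
condition for `j - 1`, so that the losses of `q ^ (ε n)` accumulate only `j` times. For `j = 0`
the condition reads `n = 0`. -/
theorem exists_largeSieveBound_of_mul_le (F : Type*) [Field F] [Fintype F] (j : ℕ) :
    ∀ ε : ℝ, 0 < ε → ∃ K : ℝ, 1 ≤ K ∧ ∀ θ : MulChar F ℂ, θ ^ 2 ≠ 1 → θ (-1) = 1 →
      ∀ n k : ℕ, (j + 1) * n ≤ j * k → LargeSieveBound θ n k
        (K * (Fintype.card F : ℝ) ^ (ε * ((n : ℝ) + k)) * ((Fintype.card F : ℝ) ^ (k : ℝ) +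
          (Fintype.card F : ℝ) ^ (2 * ((n : ℝ) + k) / 3))) := by
  classical
  have hQ := one_lt_card_real F
  have hQ0 : (0 : ℝ) < Fintype.card F := by linarith
  induction j with
  | zero =>
    intro ε hε
    refine ⟨1, le_rfl, fun θ _ _ n k hn => ?_⟩
    -- the condition forces `n = 0`, where the only modulus is `1`
    obtain rfl : n = 0 := by omega
    refine (largeSieveBound_zero_left k).mono ?_
    rw [one_mul, ← Real.rpow_natCast]
    have h1 := Real.one_le_rpow hQ.le (show 0 ≤ ε * (((0 : ℕ) : ℝ) + k) by positivity)
    have h2 : 0 ≤ (Fintype.card F : ℝ) ^ (2 * (((0 : ℕ) : ℝ) + k) / 3) := by positivity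
    exact (le_add_of_nonneg_right h2).trans (le_mul_of_one_le_left (by positivity) h1)
  | succ j ih =>
    intro ε hε
    set Q : ℝ := (Fintype.card F : ℝ)
    -- the divisor function enters to the power `6`, the number of degrees `(α, β, γ)` once and the
    -- inductive bound for moduli of degree and length at most `n`: `6 / 12 + 1 / 4 + 2 / 8 = 1`
    obtain ⟨Kd, hKd, hdiv⟩ := exists_card_filter_dvd_le F (ε := ε / 12) (by positivity)
    obtain ⟨Kp, hKp, hpoly⟩ := exists_pow_three_le_rpow hQ (ε := ε / 4) (by positivity)
    obtain ⟨Kj, hKj, hj⟩ := ih (ε / 8) (by positivity)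
    refine ⟨2 * Kd ^ 6 * Kp * Kj * Q ^ (4 + ε / 8), ?_, fun θ hθ2 hθ1 n k hnk => ?_⟩
    · have h1 : 1 ≤ Kd ^ 6 := one_le_pow₀ hKd
      have h2 : 1 ≤ Q ^ (4 + ε / 8) := Real.one_le_rpow hQ.le (by positivity)
      have h3 := one_le_mul_of_one_le_of_one_le (one_le_mul_of_one_le_of_one_le
        (one_le_mul_of_one_le_of_one_le h1 hKp) hKj) h2
      nlinarith
    have hle : n ≤ k := by nlinarith
    have hθ : θ ≠ 1 := by rintro rfl; exact hθ2 (one_pow 2)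
    have hθ21 : (θ ^ 2) (-1) = 1 := by rw [MulChar.pow_apply' _ two_ne_zero, hθ1, one_pow]
    set T := Kd * Q ^ (ε / 12 * n) with hT
    set V := Kj * Kd ^ 3 * Q * Q ^ (ε / 4 * n + ε / 8 * (2 * n + 1)) with hV
    set B := Q ^ (k : ℝ) + Q ^ (2 * ((n : ℝ) + k) / 3) with hB
    have hV1 : 1 ≤ V := by
      have h1 : 1 ≤ Kd ^ 3 := one_le_pow₀ hKd
      have h2 : 1 ≤ Q ^ (ε / 4 * n + ε / 8 * (2 * n + 1)) := Real.one_le_rpow hQ.le (by positivity)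
      exact one_le_mul_of_one_le_of_one_le (one_le_mul_of_one_le_of_one_le
        (one_le_mul_of_one_le_of_one_le hKj h1) hQ.le) h2
    have hP1 : 1 ≤ Kp * Q ^ (ε / 4 * n) :=
      one_le_mul_of_one_le_of_one_le hKp (Real.one_le_rpow hQ.le (by positivity))
    have key : LargeSieveBound θ n k (T ^ 3 * (2 * Q ^ 3 * (Kp * Q ^ (ε / 4 * n)) * V * B)) := by
      refine largeSieveBound_of_dual hθ hθ1 hle (hdiv n) (by positivity) fun s r e hs hr he => ?_
      rcases Nat.eq_zero_or_pos (2 * s - (k - e)) with hκ | hκ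
      · -- only the dual variable `h = 0` is left
        refine ⟨1, zero_le_one, by rw [hκ]; exact largeSieveBound_zero_right r, ?_⟩
        rw [mul_one]
        have h1 : Q ^ (k - e) / Q ^ s ≤ Q ^ (k : ℝ) := by
          rw [Real.rpow_natCast]
          exact (div_le_self (by positivity) (one_le_pow₀ hQ.le)).trans
            (pow_le_pow_right₀ hQ.le (Nat.sub_le _ _))
        have h2 : 1 ≤ 2 * Q ^ 3 * (Kp * Q ^ (ε / 4 * n)) * V := by
          have : 1 ≤ Q ^ 3 := one_le_pow₀ hQ.le
          have := one_le_mul_of_one_le_of_one_le (one_le_mul_of_one_le_of_one_le this hP1) hV1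
          linarith
        have h3 : Q ^ (k : ℝ) ≤ B := le_add_of_nonneg_right (by positivity)
        have h4 : 0 ≤ B := by positivity
        nlinarith
      · set κ := 2 * s - (k - e) with hκdef
        have hκs : κ ≤ s := by omega
        have hsn : (s : ℝ) ≤ n := by exact_mod_cast hs
        have hκsn : κ ≤ s + n - k := by omega
        refine ⟨_, ?_, largeSieveBound_short hθ1 hr hκ hκs (V := V) (by positivity) ?_ ?_, ?_⟩
        · positivity
        · intro α hα
          have hαn : (α : ℝ) ≤ n := by exact_mod_cast (by omega : α ≤ n)
          -- from `α ≤ s + n - k` and `(j + 2) n ≤ (j + 1) k`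
          have hcond : (j + 1) * α ≤ j * (s + 1) := by
            obtain ⟨d, hd⟩ : ∃ d, s + n = k + α + d := ⟨s + n - k - α, by omega⟩
            nlinarith
          refine (hj θ hθ2 hθ1 α (s + 1) hcond).mono ?_
          have h1 : Q ^ (ε / 8 * ((α : ℝ) + (s + 1 : ℕ))) ≤
              Q ^ (ε / 4 * n + ε / 8 * (2 * n + 1)) := by
            refine Real.rpow_le_rpow_of_exponent_le hQ.le ?_
            push_cast
            have : 0 ≤ ε / 4 * n := by positivity
            nlinarith
          have h2 : Q ^ ((s + 1 : ℕ) : ℝ) = Q * Q ^ (s : ℝ) := by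
            push_cast
            rw [Real.rpow_add hQ0, Real.rpow_one, mul_comm]
          have h3 : Q ^ (2 * ((α : ℝ) + (s + 1 : ℕ)) / 3) ≤ Q * Q ^ (2 * ((α : ℝ) + s) / 3) := by
            nth_rw 2 [← Real.rpow_one Q]
            rw [← Real.rpow_add hQ0]
            refine Real.rpow_le_rpow_of_exponent_le hQ.le ?_
            push_cast
            linarith
          have h4 : 1 ≤ Kd ^ 3 := one_le_pow₀ hKd
          calc Kj * Q ^ (ε / 8 * ((α : ℝ) + (s + 1 : ℕ))) *
                (Q ^ ((s + 1 : ℕ) : ℝ) + Q ^ (2 * ((α : ℝ) + (s + 1 : ℕ)) / 3))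
              ≤ Kj * Q ^ (ε / 4 * n + ε / 8 * (2 * n + 1)) *
                (Q * Q ^ (s : ℝ) + Q * Q ^ (2 * ((α : ℝ) + s) / 3)) := by
                rw [h2]; gcongr
            _ = 1 * (Kj * Q ^ (ε / 4 * n + ε / 8 * (2 * n + 1)) *
                (Q * (Q ^ (s : ℝ) + Q ^ (2 * ((α : ℝ) + s) / 3)))) := by ring
            _ ≤ Kd ^ 3 * (Kj * Q ^ (ε / 4 * n + ε / 8 * (2 * n + 1)) *
                (Q * (Q ^ (s : ℝ) + Q ^ (2 * ((α : ℝ) + s) / 3)))) := by gcongr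
            _ = V * (Q ^ (s : ℝ) + Q ^ (2 * ((α : ℝ) + s) / 3)) := by rw [hV]; ring
        · -- here `2 β ≤ s + 1`, and orthogonality of the characters of `θ ^ 2` is enough
          intro β hβ
          have hβn : (β : ℝ) ≤ n := by exact_mod_cast (by omega : β ≤ n)
          refine (largeSieveBound_of_two_mul_le hθ2 hθ21 (by omega) (hdiv β)).mono ?_
          have h1 : (Q ^ (ε / 12 * (β : ℝ))) ^ 3 ≤ Q ^ (ε / 4 * n + ε / 8 * (2 * n + 1)) := by
            rw [← Real.rpow_natCast, ← Real.rpow_mul hQ0.le]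
            refine Real.rpow_le_rpow_of_exponent_le hQ.le ?_
            push_cast
            have : 0 ≤ ε / 8 * (2 * (n : ℝ) + 1) := by positivity
            nlinarith
          calc (Kd * Q ^ (ε / 12 * (β : ℝ))) ^ 3 * Q ^ (s + 1)
              = 1 * (Kd ^ 3 * (Q ^ (ε / 12 * (β : ℝ))) ^ 3 * (Q * Q ^ (s : ℝ))) := by
                rw [Real.rpow_natCast]; ring
            _ ≤ Kj * (Kd ^ 3 * Q ^ (ε / 4 * n + ε / 8 * (2 * n + 1)) * (Q * Q ^ (s : ℝ))) := by
                gcongr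
            _ = V * Q ^ (s : ℝ) := by rw [hV]; ring
        · have h1 : (κ : ℝ) ^ 3 ≤ Kp * Q ^ (ε / 4 * n) := by
            refine le_trans ?_ (hpoly n)
            have : (κ : ℝ) ≤ n := by exact_mod_cast (by omega : κ ≤ n)
            gcongr
          have h2 : Q ^ (k - e) / Q ^ s * Q ^ ((s : ℝ) + κ / 3) ≤ B := by
            refine le_trans ?_ (le_add_of_nonneg_left (by positivity))
            rw [← Real.rpow_natCast, ← Real.rpow_natCast, ← Real.rpow_sub hQ0, ← Real.rpow_add hQ0]
            refine Real.rpow_le_rpow_of_exponent_le hQ.le ?_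
            have h3 : (κ : ℝ) + (k - e : ℕ) = 2 * s := by
              exact_mod_cast (by omega : κ + (k - e) = 2 * s)
            have h4 : ((k - e : ℕ) : ℝ) ≤ k := by exact_mod_cast Nat.sub_le _ _
            linarith
          calc Q ^ (k - e) / Q ^ s * (Q * (κ : ℝ) ^ 3 * (2 * Q ^ 2 * V * Q ^ ((s : ℝ) + κ / 3)))
              = 2 * Q ^ 3 * (κ : ℝ) ^ 3 * V * (Q ^ (k - e) / Q ^ s * Q ^ ((s : ℝ) + κ / 3)) := by
                ring
            _ ≤ 2 * Q ^ 3 * (Kp * Q ^ (ε / 4 * n)) * V * B := by gcongr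
    refine key.mono ?_
    have h1 : T ^ 3 = Kd ^ 3 * Q ^ (ε / 4 * n) := by
      rw [hT, mul_pow, ← Real.rpow_natCast (Q ^ _), ← Real.rpow_mul hQ0.le]
      congr 2
      push_cast
      ring
    have h2 : Q ^ (ε / 4 * n) * Q ^ (ε / 4 * n) * Q ^ (ε / 4 * n + ε / 8 * (2 * n + 1)) * Q ^ 4 ≤
        Q ^ (4 + ε / 8) * Q ^ (ε * ((n : ℝ) + k)) := by
      rw [← Real.rpow_natCast Q 4, ← Real.rpow_add hQ0, ← Real.rpow_add hQ0, ← Real.rpow_add hQ0,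
        ← Real.rpow_add hQ0]
      refine Real.rpow_le_rpow_of_exponent_le hQ.le ?_
      push_cast
      have : 0 ≤ ε * (k : ℝ) := by positivity
      linarith
    calc T ^ 3 * (2 * Q ^ 3 * (Kp * Q ^ (ε / 4 * n)) * V * B)
        = 2 * Kd ^ 6 * Kp * Kj * (Q ^ (ε / 4 * n) * Q ^ (ε / 4 * n) *
            Q ^ (ε / 4 * n + ε / 8 * (2 * n + 1)) * Q ^ 4) * B := by rw [h1, hV]; ring
      _ ≤ 2 * Kd ^ 6 * Kp * Kj * (Q ^ (4 + ε / 8) * Q ^ (ε * ((n : ℝ) + k))) * B := by gcongr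
      _ = 2 * Kd ^ 6 * Kp * Kj * Q ^ (4 + ε / 8) * Q ^ (ε * ((n : ℝ) + k)) * B := by ring

/-- The bound for all `k ≥ n`: a slight increase of `k`, which costs a factor `q ^ (ε k)`, leads
into the range `k ≥ (1 + 1 / j) n` for a fixed `j` of size about `1 / ε`. -/
theorem exists_largeSieveBound (F : Type*) [Field F] [Fintype F] {ε : ℝ} (hε : 0 < ε) :
    ∃ K : ℝ, 1 ≤ K ∧ ∀ θ : MulChar F ℂ, θ ^ 2 ≠ 1 → θ (-1) = 1 →
      ∀ n k : ℕ, n ≤ k → LargeSieveBound θ n k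
        (K * (Fintype.card F : ℝ) ^ (ε * ((n : ℝ) + k)) * ((Fintype.card F : ℝ) ^ (k : ℝ) +
          (Fintype.card F : ℝ) ^ (2 * ((n : ℝ) + k) / 3))) := by
  have hQ := one_lt_card_real F
  have hQ0 : (0 : ℝ) < Fintype.card F := by linarith
  set Q : ℝ := (Fintype.card F : ℝ)
  obtain ⟨η, hη, hηε, hη1⟩ : ∃ η : ℝ, 0 < η ∧ 4 * η ≤ ε ∧ η ≤ 1 :=
    ⟨min (ε / 4) 1, by positivity, by linarith [min_le_left (ε / 4) 1], min_le_right _ _⟩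
  obtain ⟨j, hj⟩ := exists_nat_gt (1 / η)
  have hj0 : (0 : ℝ) < j := lt_trans (by positivity) hj
  have hjpos : 0 < j := by exact_mod_cast hj0
  obtain ⟨K, hK, h⟩ := exists_largeSieveBound_of_mul_le F j η hη
  refine ⟨K * Q ^ 2, one_le_mul_of_one_le_of_one_le hK (one_le_pow₀ hQ.le),
    fun θ hθ2 hθ1 n k hnk => ?_⟩
  -- the rounded-up increase `k / j + 1 > k / j` (real quotient) is enough
  have hcond : (j + 1) * n ≤ j * (k + (k / j + 1)) := by
    have h1 := Nat.div_add_mod k j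
    have h2 := Nat.mod_lt k hjpos
    nlinarith
  refine ((h θ hθ2 hθ1 n _ hcond).anti (Nat.le_add_right _ _)).mono ?_
  set δ := k / j + 1 with hδ
  have hδk : (δ : ℝ) ≤ η * k + 1 := by
    rw [hδ]
    push_cast
    have h1 : ((k / j : ℕ) : ℝ) ≤ k / j := Nat.cast_div_le
    have h2 : (k : ℝ) / j ≤ η * k := by
      rw [div_le_iff₀ hj0]
      have h3 : 1 ≤ η * j := by rw [div_lt_iff₀ hη] at hj; linarith
      nlinarith [(Nat.cast_nonneg k : (0 : ℝ) ≤ k)]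
    linarith
  have hδ0 : (0 : ℝ) ≤ δ := Nat.cast_nonneg _
  have hn0 : (0 : ℝ) ≤ n := Nat.cast_nonneg _
  have hk0 : (0 : ℝ) ≤ k := Nat.cast_nonneg _
  have hηk : η * (η * k) ≤ η * k := mul_le_of_le_one_left (by positivity) hη1
  have h1 : Q ^ (η * ((n : ℝ) + (k + δ : ℕ))) * Q ^ ((k + δ : ℕ) : ℝ) ≤
      Q ^ 2 * Q ^ (ε * ((n : ℝ) + k)) * Q ^ (k : ℝ) := by
    rw [← Real.rpow_natCast Q 2, ← Real.rpow_add hQ0, ← Real.rpow_add hQ0, ← Real.rpow_add hQ0]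
    refine Real.rpow_le_rpow_of_exponent_le hQ.le ?_
    push_cast
    nlinarith
  have h2 : Q ^ (η * ((n : ℝ) + (k + δ : ℕ))) * Q ^ (2 * ((n : ℝ) + (k + δ : ℕ)) / 3) ≤
      Q ^ 2 * Q ^ (ε * ((n : ℝ) + k)) * Q ^ (2 * ((n : ℝ) + k) / 3) := by
    rw [← Real.rpow_natCast Q 2, ← Real.rpow_add hQ0, ← Real.rpow_add hQ0, ← Real.rpow_add hQ0]
    refine Real.rpow_le_rpow_of_exponent_le hQ.le ?_
    push_cast
    nlinarith
  calc K * Q ^ (η * ((n : ℝ) + (k + δ : ℕ))) *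
        (Q ^ ((k + δ : ℕ) : ℝ) + Q ^ (2 * ((n : ℝ) + (k + δ : ℕ)) / 3))
      = K * (Q ^ (η * ((n : ℝ) + (k + δ : ℕ))) * Q ^ ((k + δ : ℕ) : ℝ) +
          Q ^ (η * ((n : ℝ) + (k + δ : ℕ))) * Q ^ (2 * ((n : ℝ) + (k + δ : ℕ)) / 3)) := by ring
    _ ≤ K * (Q ^ 2 * Q ^ (ε * ((n : ℝ) + k)) * Q ^ (k : ℝ) +
          Q ^ 2 * Q ^ (ε * ((n : ℝ) + k)) * Q ^ (2 * ((n : ℝ) + k) / 3)) := by gcongr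
    _ = _ := by ring

end

theorem theorem1p3 (F : Type*) [Field F] [Fintype F] (ε : ℝ) (hε : 0 < ε) :
    ∃ K : ℝ, 0 < K ∧
      ∀ ℓ : ℕ, 3 ≤ ℓ → Fintype.card F ≡ 1 [MOD 2 * ℓ] →
      ∀ Ω : rootsOfUnity ℓ F ≃* rootsOfUnity ℓ ℂ,
      ∀ (m n : ℕ) (lam : F[X] → ℂ),
        ∑ M ∈ monicSquarefree F m,
            ‖∑ N ∈ monicSquarefree F n, lam N * residueSymbol Ω M N‖ ^ 2 ≤
          K * (Fintype.card F : ℝ) ^ (ε * ((m : ℝ) + (n : ℝ))) *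
            ((Fintype.card F : ℝ) ^ m + (Fintype.card F : ℝ) ^ n +
              (Fintype.card F : ℝ) ^ (2 * ((m : ℝ) + (n : ℝ)) / 3)) *
            ∑ N ∈ monicSquarefree F n, ‖lam N‖ ^ 2 := by
  obtain ⟨K, hK, h⟩ := exists_largeSieveBound F hε
  have hQ := one_lt_card_real F
  have hQ0 : (0 : ℝ) < Fintype.card F := by linarith
  refine ⟨K * (Fintype.card F : ℝ) ^ (ε + 1), by positivity, fun ℓ hℓ hmod Ω m n lam => ?_⟩
  have hdvd2 : 2 * ℓ ∣ Fintype.card F - 1 :=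
    (Nat.modEq_iff_dvd' Fintype.one_lt_card.le).1 hmod.symm
  have hdvd : ℓ ∣ Fintype.card F - 1 := (dvd_mul_left ℓ 2).trans hdvd2
  have heven : Even ((Fintype.card F - 1) / ℓ) := by
    obtain ⟨c, hc⟩ := hdvd2
    rw [hc, show 2 * ℓ * c = ℓ * (2 * c) by ring, Nat.mul_div_cancel_left _ (by omega)]
    exact even_two_mul c
  set θ := residueMulChar hdvd Ω
  have hθ1 : θ (-1) = 1 := residueMulChar_neg_one hdvd heven Ω
  have hθ2 : θ ^ 2 ≠ 1 := residueMulChar_sq_ne_one hdvd hℓ Ω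
  have hsymb : ∀ M, ∑ N ∈ monicSquarefree F n, lam N * residueSymbol Ω M N =
      ∑ N ∈ monicSquarefree F n, lam N * resultantChar θ N M := fun M =>
    Finset.sum_congr rfl fun N hN => by
      rw [residueSymbol_eq hdvd (by omega) Ω (mem_monicSquarefree.1 hN).1]
  simp_rw [hsymb]
  set Q : ℝ := (Fintype.card F : ℝ)
  have hS : 0 ≤ ∑ N ∈ monicSquarefree F n, ‖lam N‖ ^ 2 := Finset.sum_nonneg fun _ _ => by positivity
  have hfinal : ∀ a b : ℕ, K * Q ^ (ε * ((a : ℝ) + (b + 1 : ℕ))) *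
      (Q ^ ((b + 1 : ℕ) : ℝ) + Q ^ (2 * ((a : ℝ) + (b + 1 : ℕ)) / 3)) ≤
      K * Q ^ (ε + 1) * Q ^ (ε * ((a : ℝ) + b)) * (Q ^ b + Q ^ (2 * ((a : ℝ) + b) / 3)) := by
    intro a b
    have h1 : Q ^ (ε * ((a : ℝ) + (b + 1 : ℕ))) = Q ^ ε * Q ^ (ε * ((a : ℝ) + b)) := by
      rw [← Real.rpow_add hQ0]; push_cast; congr 1; ring
    have h2 : Q ^ ((b + 1 : ℕ) : ℝ) = Q * Q ^ b := by
      rw [Real.rpow_natCast, pow_succ, mul_comm]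
    have h3 : Q ^ (2 * ((a : ℝ) + (b + 1 : ℕ)) / 3) ≤ Q * Q ^ (2 * ((a : ℝ) + b) / 3) := by
      nth_rw 2 [← Real.rpow_one Q]
      rw [← Real.rpow_add hQ0]
      refine Real.rpow_le_rpow_of_exponent_le hQ.le ?_
      push_cast
      linarith
    rw [h1, h2, Real.rpow_add hQ0, Real.rpow_one]
    calc K * (Q ^ ε * Q ^ (ε * ((a : ℝ) + b))) *
          (Q * Q ^ b + Q ^ (2 * ((a : ℝ) + (b + 1 : ℕ)) / 3))
        ≤ K * (Q ^ ε * Q ^ (ε * ((a : ℝ) + b))) *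
          (Q * Q ^ b + Q * Q ^ (2 * ((a : ℝ) + b) / 3)) := by gcongr
      _ = _ := by ring
  rcases le_total n m with hnm | hmn
  · refine ((h θ hθ2 hθ1 n (m + 1) (by omega)).sum_monicSquarefree (Nat.lt_succ_self m) lam).trans
      (mul_le_mul_of_nonneg_right ((hfinal n m).trans ?_) hS)
    rw [add_comm (n : ℝ) m]
    gcongr
    exact le_add_of_nonneg_right (by positivity)
  · refine ((h θ hθ2 hθ1 m (n + 1) (by omega)).dual hθ1 (by positivity)
      (Nat.lt_succ_self n) lam).trans
      (mul_le_mul_of_nonneg_right ((hfinal m n).trans ?_) hS)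
    gcongr
    exact le_add_of_nonneg_left (by positivity)
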